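/- All matrices are zero-one. A $d$-dimensional matrix $A$ *contains* $P$ if some submatrix of $A$ (obtained by selecting cross sections in each direction) can be turned into $P$ by changing some ones to zeros; otherwise $A$ *avoids* $P$. Let $f(n,P,d)$ be the maximum number of ones in a $d$-dimensional $n\times\cdots\times n$ matrix that avoids $P$. A $d$-dimensional $k\times\cdots\times k$ matrix is a *permutation matrix* if each of its cross sections, in every direction, has exactly one $1$-entry. Let $R^{k_1,\dots,k_d}$ be the $k_1\times\cdots\times k_d$ all-ones matrix. For $j\ge 1$, a *$j$-tuple permutation matrix generated by* a permutation matrix $P$ is a Kronecker product $P\otimes R^{k_1,\dots,k_d}$ (each $1$-entry of $P$ is replaced by a copy of $R^{k_1,\dots,k_d}$, each $0$-entry by a zero block) in which one of $k_1,\dots,k_d$ equals $j$ and the others equal $1$. A matrix $A$ contains a $k_1\times\cdots\times k_d$ matrix $B=(b_{i_1,\dots,i_d})$ *as an interval minor* if for each $\ell$ there are nonempty intervals $W_{\ell,1}<\cdots<W_{\ell,k_\ell}$ of consecutive indices in the $\ell$-th direction of $A$, pairwise disjoint and in increasing order, such that $A$ has a $1$-entry in $W_{1,i_1}\times\cdots\times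 W_{d,i_d}$ whenever $b_{i_1,\dots,i_d}=1$. Let $m(n,B,d)$ be the maximum number of ones in a $d$-dimensional $n\times\cdots\times n$ matrix that does not contain $B$ as an interval minor. **Theorem.** For every $d\ge 1$ there is a constant $C$, depending only on $d$, such that for every $k\ge 1$: 1. for every $d$-dimensional $k\times\cdots\times k$ permutation matrix $P$, $$\limsup_{n\to\infty}\frac{f(n,P,d)}{n^{d-1}}\le 2^{Ck};$$ 2. for every $j\ge 1$ and every $j$-tuple permutation matrix $P'$ generated by a $d$-dimensional $k\times\cdots\times k$ permutation matrix, $$\limsup_{n\to\infty}\frac{f(n,P',d)}{n^{d-1}}\le j\,2^{Ck},$$ which is $2^{O(k)}$ for fixed $d$ and $j$; 3. $m(n,R^{k,\dots,k},d)\le 2^{Ck}\,n^{d-1}$ for every $n\ge 1$. -/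

import Mathlib

/-- A `d`-dimensional `n 0 × ⋯ × n (d-1)` zero-one matrix; `true` stands for the entry `1` and
`false` for the entry `0`. -/
abbrev ZeroOneMatrix {d : ℕ} (n : Fin d → ℕ) : Type := (∀ i, Fin (n i)) → Bool

namespace ZeroOneMatrix

variable {d : ℕ}

/-- The number of `1`-entries. -/
def weight {n : Fin d → ℕ} (A : ZeroOneMatrix n) : ℕ :=
  (Finset.univ.filter fun x => A x = true).card

/-- `A` contains `P`: some submatrix of `A`, given by selecting cross sections (in increasing
order) in every direction, can be turned into `P` by changing some ones to zeros. -/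
def Contains {n p : Fin d → ℕ} (A : ZeroOneMatrix n) (P : ZeroOneMatrix p) : Prop :=
  ∃ g : ∀ i, Fin (p i) ↪o Fin (n i), ∀ y, P y = true → A (fun i => g i (y i)) = true

/-- `A` contains `B` as an interval minor: in every direction `i` there are nonempty, pairwise
disjoint, increasingly ordered intervals `W i j = [a i j, b i j]`, one for each `i`-cross section
of `B`, such that the block `∏ i, W i (y i)` of `A` has a `1`-entry whenever `B y = 1`. -/
def ContainsIntervalMinor {n p : Fin d → ℕ} (A : ZeroOneMatrix n) (B : ZeroOneMatrix p) : Prop :=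
  ∃ a b : ∀ i, Fin (p i) → Fin (n i),
    (∀ i j, a i j ≤ b i j) ∧
    (∀ i j j', j < j' → b i j < a i j') ∧
    ∀ y, B y = true → ∃ x, (∀ i, a i (y i) ≤ x i ∧ x i ≤ b i (y i)) ∧ A x = true

open Classical in
/-- The extremal function `f(n, P, d)`: the maximum number of ones in a `d`-dimensional
`n × ⋯ × n` zero-one matrix that avoids `P`. -/
noncomputable def extremal (n : ℕ) {p : Fin d → ℕ} (P : ZeroOneMatrix p) : ℕ :=
  (Finset.univ.filter fun A : ZeroOneMatrix (fun _ : Fin d => n) => ¬ A.Contains P).sup weight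

open Classical in
/-- The function `m(n, P, d)`: the maximum number of ones in a `d`-dimensional
`n × ⋯ × n` zero-one matrix that avoids `P` as an interval minor. -/
noncomputable def minorExtremal (n : ℕ) {p : Fin d → ℕ} (P : ZeroOneMatrix p) : ℕ :=
  (Finset.univ.filter fun A : ZeroOneMatrix (fun _ : Fin d => n) =>
    ¬ A.ContainsIntervalMinor P).sup weight

/-- `S(P, d) = limsup_{n → ∞} f(n, P, d) / n ^ (d - 1)`, as an extended real number. -/
noncomputable def limsupExtremal {p : Fin d → ℕ} (P : ZeroOneMatrix p) : EReal :=
  Filter.limsup (fun n : ℕ => (((extremal n P : ℝ) / (n : ℝ) ^ (d - 1) : ℝ) : EReal)) Filter.atTop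

/-- A `k × ⋯ × k` matrix is a permutation matrix if each of its cross sections, in every
direction, has exactly one `1`-entry. -/
def IsPermutation {k : ℕ} (P : ZeroOneMatrix (fun _ : Fin d => k)) : Prop :=
  ∀ (l : Fin d) (c : Fin k), ∃! x : Fin d → Fin k, x l = c ∧ P x = true

/-- The all-ones matrix `R^{r 0, …, r (d-1)}`. -/
def allOnes (r : Fin d → ℕ) : ZeroOneMatrix r := fun _ => true

/-- The Kronecker product: each `1`-entry of `M` is replaced by a copy of `N`, and each `0`-entry
by a zero matrix of the size of `N`. -/
def kronecker {m n : Fin d → ℕ} (M : ZeroOneMatrix m) (N : ZeroOneMatrix n) :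
    ZeroOneMatrix (fun i => m i * n i) :=
  fun x => M (fun i => (x i).divNat) && N (fun i => (x i).modNat)

/-- The `j`-tuple matrix generated by `P` in direction `l`: the Kronecker product of `P` with the
all-ones matrix of size `1 × ⋯ × j × ⋯ × 1`, where `j` stands in position `l`. -/
def tuple {k : ℕ} (P : ZeroOneMatrix (fun _ : Fin d => k)) (l : Fin d) (j : ℕ) :
    ZeroOneMatrix (fun i => k * Function.update (fun _ : Fin d => 1) l j i) :=
  kronecker P (allOnes (Function.update (fun _ : Fin d => 1) l j))

end ZeroOneMatrix

/-! All the bounds come from one fact, `exists_cuts_of_lt_weight`: more than `j * 2 ^ (C * k) * n ^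
(d - 1)` ones force a `k × ⋯ × k` grid of boxes, each with `j` ones on a common line in a prescribed
direction. For `j = 1` this is the interval minor. A permutation matrix, or a tuple of one, embeds
by taking the rows it needs from the boxes at its 1-entries; no two 1-entries of `P` share a cross
section, so the choices do not interfere.

To carry the `j` ones along, the ones on each line are cut into blocks of `j`, and each block
becomes a segment. Induction on the number `D` of directions across the segments shows that a
segment family without a minor of size `k` has `2 ^ O(k) * n ^ D` members
(`exists_card_le_of_not_hasSegmentMinor`). For fixed `D ≥ 1` the grid is contracted by `t = 2 ^ (4 *
k + 1)` in all `D + 1` directions. Each contraction loses a factor at most `2 ^ (2 * k)`, up to an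
error coming from crowded places: groups of segments on many merged lines, or blocks containing many
segments of one line. The total loss is less than `t ^ D`, so the bound propagates from scale `n` to
`t * n`.

Crowded places are few by `exists_common_cuts`. Among more than `M * t ^ 2` of them in one slab of
width `t`, more than `M` have points between the same cuts of the slab. These form a family with one
direction fewer; a minor there, combined with the common cuts, is a minor of the original family.
Asking for `2 ^ l` points to obtain `l + 1` cut intervals makes dyadic halving possible, and a
factor `2 ^ τ * τ.choose l ≤ t ^ 2` suffices for `t = 2 ^ τ`. Pigeonholing over all `k`-subsets of a
slab would instead cost `t.choose k`, whose exponent is not linear in `k`. -/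

/-! ### Common cuts by dyadic halving -/

/-- If many objects carry at least `2 ^ l` points each in a dyadic interval, then many of them have
points in each of `l + 1` common consecutive intervals. -/
theorem exists_common_cuts {Ω : Type*} (m i : ℕ) :
    ∀ (P : Ω → Finset ℕ) (l a : ℕ) (U : Finset Ω), (∀ ω ∈ U, ∀ x ∈ P ω, a ≤ x ∧ x < a + 2 ^ i) →
      (∀ ω ∈ U, 2 ^ l ≤ (P ω).card) → m * (2 ^ i * i.choose l) < U.card →
      ∃ U' ⊆ U, m < U'.card ∧ ∃ c : ℕ → ℕ, Monotone c ∧ (∀ r, a ≤ c r ∧ c r ≤ a + 2 ^ i) ∧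
        ∀ ω ∈ U', ∀ r ≤ l, ∃ x ∈ P ω, c r ≤ x ∧ x < c (r + 1) := by
  classical
  have base : ∀ (i : ℕ) (P : Ω → Finset ℕ) (a : ℕ) (U : Finset Ω), (∀ ω ∈ U, ∀ x ∈ P ω, a ≤ x ∧ x < a + 2 ^ i) →
      (∀ ω ∈ U, 2 ^ 0 ≤ (P ω).card) → m * (2 ^ i * i.choose 0) < U.card →
      ∃ U' ⊆ U, m < U'.card ∧ ∃ c : ℕ → ℕ, Monotone c ∧ (∀ r, a ≤ c r ∧ c r ≤ a + 2 ^ i) ∧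
        ∀ ω ∈ U', ∀ r ≤ 0, ∃ x ∈ P ω, c r ≤ x ∧ x < c (r + 1) := by
    intro i P a U hP hc hU
    have hpos : 0 < 2 ^ i := by positivity
    refine ⟨U, subset_rfl, ?_, fun r => if r = 0 then a else a + 2 ^ i, ?_, ?_, ?_⟩
    · have : 1 ≤ 2 ^ i := Nat.one_le_two_pow
      simp only [Nat.choose_zero_right, mul_one] at hU
      nlinarith
    · intro r r' h
      dsimp only
      split_ifs <;> omega
    · intro r
      dsimp only
      split_ifs <;> omega
    · intro ω hω r hr
      obtain ⟨x, hx⟩ : (P ω).Nonempty := Finset.card_pos.mp (by simpa using hc ω hω)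
      obtain rfl : r = 0 := by omega
      exact ⟨x, hx, by simpa using hP ω hω x hx⟩
  induction i with
  | zero =>
    intro P l a U hP hc hU
    cases l with
    | zero => exact base 0 P a U hP hc hU
    | succ l =>
      exfalso
      obtain ⟨ω, hω⟩ : U.Nonempty := Finset.card_pos.mp (by omega)
      have h1 : (P ω).card ≤ 1 := Finset.card_le_one.mpr fun x hx y hy => by
        have := hP ω hω x hx
        have := hP ω hω y hy
        simp only [pow_zero] at *
        omega
      have := hc ω hω
      have : 1 ≤ 2 ^ l := Nat.one_le_two_pow
      rw [pow_succ] at *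
      omega
  | succ i ih =>
    intro P l a U hP hc hU
    cases l with
    | zero => exact base _ P a U hP hc hU
    | succ l =>
      have e2 : 2 ^ (i + 1) = 2 ^ i + 2 ^ i := by ring
      have hpos : 0 < 2 ^ i := by positivity
      set b := a + 2 ^ i with hb
      let PL : Ω → Finset ℕ := fun ω => (P ω).filter (· < b)
      let PR : Ω → Finset ℕ := fun ω => (P ω).filter fun x => ¬ x < b
      have hsum : ∀ ω, (PL ω).card + (PR ω).card = (P ω).card := fun ω =>
        Finset.card_filter_add_card_filter_not _
      let UL := U.filter fun ω => PR ω = ∅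
      let UR := U.filter fun ω => PL ω = ∅
      let VL := U.filter fun ω => 2 ^ l ≤ (PL ω).card ∧ (PR ω).Nonempty
      let VR := U.filter fun ω => 2 ^ l ≤ (PR ω).card ∧ (PL ω).Nonempty
      -- A point set lies in one half, or meets both halves and has at least `2 ^ l` of its `2 ^ (l
      -- + 1)` points in one of them.
      have hcover : U ⊆ UL ∪ UR ∪ VL ∪ VR := by
        intro ω hω
        simp only [UL, UR, VL, VR, Finset.mem_union, Finset.mem_filter, hω, true_and]
        rcases (PL ω).eq_empty_or_nonempty with h | h
        · simp [h]
        rcases (PR ω).eq_empty_or_nonempty with h' | h'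
        · simp [h']
        simp only [h, h', and_true]
        have := hsum ω
        have := hc ω hω
        rw [pow_succ] at this
        omega
      have hcard : U.card ≤ UL.card + UR.card + VL.card + VR.card :=
        (Finset.card_le_card hcover).trans <| by
          grw [Finset.card_union_le, Finset.card_union_le, Finset.card_union_le]
      -- Pascal's rule makes the threshold the exact sum of the thresholds of the four classes, so
      -- one class exceeds its own.
      have hch : m * (2 ^ (i + 1) * (i + 1).choose (l + 1)) =
          2 * (m * (2 ^ i * i.choose l)) + 2 * (m * (2 ^ i * i.choose (l + 1))) := by
        rw [Nat.choose_succ_succ]; ring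
      have hor : m * (2 ^ i * i.choose (l + 1)) < UL.card ∨
          m * (2 ^ i * i.choose (l + 1)) < UR.card ∨
          m * (2 ^ i * i.choose l) < VL.card ∨ m * (2 ^ i * i.choose l) < VR.card := by
        omega
      rcases hor with h | h | h | h
      · obtain ⟨U', hU', hm, c, hc1, hc2, hc3⟩ := ih P (l + 1) a UL (fun ω hω x hx => by
          simp only [UL, Finset.mem_filter] at hω
          have h1 : x ∉ PR ω := by simp [hω.2]
          have := hP ω hω.1 x hx
          simp only [PR, Finset.mem_filter, hx, true_and, not_not] at h1
          omega) (fun ω hω => hc ω (Finset.mem_filter.mp hω).1) h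
        exact ⟨U', hU'.trans (Finset.filter_subset _ _), hm, c, hc1,
          fun r => ⟨(hc2 r).1, (hc2 r).2.trans (by omega)⟩, hc3⟩
      · obtain ⟨U', hU', hm, c, hc1, hc2, hc3⟩ := ih P (l + 1) b UR (fun ω hω x hx => by
          simp only [UR, Finset.mem_filter] at hω
          have h1 : x ∉ PL ω := by simp [hω.2]
          have := hP ω hω.1 x hx
          simp only [PL, Finset.mem_filter, hx, true_and] at h1
          omega) (fun ω hω => hc ω (Finset.mem_filter.mp hω).1) h
        exact ⟨U', hU'.trans (Finset.filter_subset _ _), hm, c, hc1,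
          fun r => ⟨le_trans (by omega) (hc2 r).1, (hc2 r).2.trans (by omega)⟩, hc3⟩
      · obtain ⟨U', hU', hm, c, hc1, hc2, hc3⟩ := ih PL l a VL (fun ω hω x hx => by
          have := hP ω (Finset.mem_filter.mp hω).1 x (Finset.mem_filter.mp hx).1
          have := (Finset.mem_filter.mp hx).2
          omega) (fun ω hω => (Finset.mem_filter.mp hω).2.1) h
        -- The cuts found in the left half stay at most `b`, so the last interval, prolonged to the
        -- right end, contains the nonempty right part of every set.
        refine ⟨U', hU'.trans (Finset.filter_subset _ _), hm,
          fun r => if r ≤ l + 1 then c r else a + 2 ^ (i + 1), ?_, ?_, ?_⟩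
        · intro r r' hr
          have h1 := hc1 hr
          have h2 := (hc2 r).2
          dsimp only
          split_ifs <;> omega
        · intro r
          have h2 := hc2 r
          dsimp only
          split_ifs <;> omega
        · intro ω hω r hr
          rcases Nat.lt_or_ge l r with hlr | hlr
          · obtain rfl : r = l + 1 := by omega
            obtain ⟨x, hx⟩ := (Finset.mem_filter.mp (hU' hω)).2.2
            obtain ⟨hx, hxb⟩ := Finset.mem_filter.mp hx
            refine ⟨x, hx, ?_⟩
            have := hP ω (Finset.mem_filter.mp (hU' hω)).1 x hx
            have := (hc2 (l + 1)).2
            simp only [le_refl, if_true, show ¬ l + 1 + 1 ≤ l + 1 by omega, if_false]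
            omega
          · obtain ⟨x, hx, h1⟩ := hc3 ω hω r hlr
            exact ⟨x, (Finset.mem_filter.mp hx).1, by
              simpa [show r ≤ l + 1 by omega, hlr] using h1⟩
      · obtain ⟨U', hU', hm, c, hc1, hc2, hc3⟩ := ih PR l b VR (fun ω hω x hx => by
          have := hP ω (Finset.mem_filter.mp hω).1 x (Finset.mem_filter.mp hx).1
          have := (Finset.mem_filter.mp hx).2
          omega) (fun ω hω => (Finset.mem_filter.mp hω).2.1) h
        -- Mirror case: a new first interval starting at `a` catches the left part, and the old cuts
        -- shift by one index.
        refine ⟨U', hU'.trans (Finset.filter_subset _ _), hm,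
          fun r => if r = 0 then a else c (r - 1), ?_, ?_, ?_⟩
        · intro r r' hr
          have h1 := hc1 (show r - 1 ≤ r' - 1 by omega)
          have h2 := (hc2 (r' - 1)).1
          dsimp only
          split_ifs <;> omega
        · intro r
          have h2 := hc2 (r - 1)
          dsimp only
          split_ifs <;> omega
        · intro ω hω r hr
          rcases r with _ | r
          · obtain ⟨x, hx⟩ := (Finset.mem_filter.mp (hU' hω)).2.2
            obtain ⟨hx, hxb⟩ := Finset.mem_filter.mp hx
            refine ⟨x, hx, ?_⟩
            have := hP ω (Finset.mem_filter.mp (hU' hω)).1 x hx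
            have := (hc2 0).1
            simp only [if_true, Nat.add_eq_zero_iff, one_ne_zero, and_false, if_false]
            simp only [zero_add, Nat.sub_self]
            omega
          · obtain ⟨x, hx, h1⟩ := hc3 ω hω r (by omega)
            exact ⟨x, (Finset.mem_filter.mp hx).1, by simpa using h1⟩

/-! ### Selecting disjoint intervals on a line -/

/-- Two intervals `[p, q]` and `[p', q']`, given as pairs, are disjoint. -/
def IntervalsDisjoint (u v : ℕ × ℕ) : Prop := u.2 < v.1 ∨ v.2 < u.1

/-- Pigeonhole: the most frequent label carries at least a `1 / s` share of the intervals, and these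
are disjoint already. -/
theorem exists_intervals_card_le {α : Type*} [DecidableEq α] (s : ℕ) (Q : Finset (α × ℕ × ℕ))
    (hQ : ∀ u ∈ Q, ∀ v ∈ Q, u.1 = v.1 → u ≠ v → IntervalsDisjoint u.2 v.2)
    (hs : (Q.image Prod.fst).card ≤ s) :
    ∃ F : Finset (ℕ × ℕ), (∀ u ∈ F, ∃ a, (a, u) ∈ Q) ∧
      (∀ u ∈ F, ∀ v ∈ F, u ≠ v → IntervalsDisjoint u v) ∧ Q.card ≤ s * F.card := by
  rcases Q.eq_empty_or_nonempty with rfl | hne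
  · exact ⟨∅, by simp⟩
  obtain ⟨a, ha, hmax⟩ := Finset.exists_max_image (Q.image Prod.fst)
    (fun a => (Q.filter (·.1 = a)).card) (hne.image _)
  refine ⟨(Q.filter (·.1 = a)).image Prod.snd, ?_, ?_, ?_⟩
  · simp only [Finset.mem_image, Finset.mem_filter]
    rintro _ ⟨u, ⟨hu, rfl⟩, rfl⟩
    exact ⟨_, hu⟩
  · simp only [Finset.mem_image, Finset.mem_filter]
    rintro _ ⟨u, ⟨hu, rfl⟩, rfl⟩ _ ⟨v, ⟨hv, hva⟩, rfl⟩ huv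
    exact hQ u hu v hv hva.symm fun h => huv (by rw [h])
  · rw [Finset.card_image_of_injOn (fun u hu v hv h => Prod.ext
      ((Finset.mem_filter.mp hu).2.trans (Finset.mem_filter.mp hv).2.symm) h)]
    calc Q.card ≤ (Q.image Prod.fst).card * (Q.filter (·.1 = a)).card := by
          rw [mul_comm]
          exact Finset.card_le_mul_card_image Q _ fun b hb => hmax b hb
      _ ≤ _ := Nat.mul_le_mul_right _ hs

/-- In a family of labelled intervals with at most `t` labels, in which intervals with the same
label are disjoint, up to a factor `s` one can select pairwise disjoint intervals, at the cost of
`t` for each member of a family of disjoint groups in which `s` labels occur. -/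
theorem exists_intervals_groups {α : Type*} [DecidableEq α] (s t : ℕ) (hs : 0 < s) :
    ∀ (m lo : ℕ) (Q : Finset (α × ℕ × ℕ)), Q.card = m → (∀ u ∈ Q, lo ≤ u.2.1) →
      (∀ u ∈ Q, u.2.1 ≤ u.2.2) →
      (∀ u ∈ Q, ∀ v ∈ Q, u.1 = v.1 → u ≠ v → IntervalsDisjoint u.2 v.2) →
      (Q.image Prod.fst).card ≤ t →
    ∃ F G : Finset (ℕ × ℕ), (∀ u ∈ F, ∃ a, (a, u) ∈ Q) ∧
      (∀ u ∈ F, ∀ v ∈ F, u ≠ v → IntervalsDisjoint u v) ∧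
      (∀ u ∈ G, lo ≤ u.1 ∧ u.1 ≤ u.2 ∧ (∃ v ∈ Q, u.2 ≤ v.2.2) ∧
        s ≤ ((Q.filter fun v => u.1 ≤ v.2.1 ∧ v.2.2 ≤ u.2).image Prod.fst).card) ∧
      (∀ u ∈ G, ∀ v ∈ G, u ≠ v → IntervalsDisjoint u v) ∧
      Q.card ≤ s * F.card + t * G.card := by
  intro m
  induction m using Nat.strong_induction_on with
  | _ m ih =>
  intro lo Q hm hlo hle hQ ht
  rcases Nat.lt_or_ge (Q.image Prod.fst).card s with hlt | hge
  · obtain ⟨F, h1, h2, h3⟩ := exists_intervals_card_le s Q hQ hlt.le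
    exact ⟨F, ∅, h1, h2, by simp, by simp, by simpa using h3⟩
  have hex : ∃ b, s ≤ ((Q.filter fun v => v.2.2 ≤ b).image Prod.fst).card := by
    refine ⟨Q.sup fun v => v.2.2, ?_⟩
    rwa [Finset.filter_true_of_mem fun v hv => Finset.le_sup (f := fun v => v.2.2) hv]
  classical
  -- Sweep from the left: `b` is the first position by which intervals of `s` labels have ended.
  -- Intervals ending before `b` are handled by pigeonhole, those through `b` are charged to the
  -- group `(lo, b)`, and the sweep restarts at `b + 1`.
  set b := Nat.find hex with hb
  have hbs := Nat.find_spec hex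
  rw [← hb] at hbs
  have hb' : ((Q.filter fun v => v.2.2 < b).image Prod.fst).card ≤ s := by
    rcases Nat.eq_zero_or_pos b with h0 | h0
    · simp [h0]
    · have := Nat.find_min hex (show b - 1 < b by omega)
      have e : (Q.filter fun v => v.2.2 < b) = Q.filter fun v => v.2.2 ≤ b - 1 :=
        Finset.filter_congr fun v _ => by omega
      rw [e]
      omega
  obtain ⟨F₀, hF₀, hF₀', hF₀c⟩ := exists_intervals_card_le s (Q.filter fun v => v.2.2 < b)
    (fun u hu v hv => hQ u (Finset.mem_filter.mp hu).1 v (Finset.mem_filter.mp hv).1) hb'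
  -- Two intervals through `b` intersect, so each label has at most one.
  have hmid : (Q.filter fun v => v.2.1 ≤ b ∧ b ≤ v.2.2).card ≤ t := by
    refine le_trans ?_ ht
    refine Finset.card_le_card_of_injOn Prod.fst
      (fun v hv => Finset.mem_image_of_mem _ (Finset.mem_filter.mp hv).1) ?_
    intro u hu v hv huv
    by_contra hne
    obtain ⟨hu, hu'⟩ := Finset.mem_filter.mp hu
    obtain ⟨hv, hv'⟩ := Finset.mem_filter.mp hv
    have := hQ u hu v hv huv hne
    unfold IntervalsDisjoint at this
    omega
  obtain ⟨w, hw⟩ : (Q.filter fun v => v.2.2 ≤ b).Nonempty := by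
    rw [← Finset.card_pos]
    exact lt_of_lt_of_le (lt_of_lt_of_le hs hbs) Finset.card_image_le
  obtain ⟨hw, hwb⟩ := Finset.mem_filter.mp hw
  have hwl := hlo w hw
  have hwle := hle w hw
  have hsub : (Q.filter fun v => b < v.2.1) ⊆ Q := Finset.filter_subset _ _
  have hlt : (Q.filter fun v => b < v.2.1).card < m := by
    rw [← hm]
    refine Finset.card_lt_card (Finset.ssubset_iff_subset_ne.mpr ⟨hsub, fun h => ?_⟩)
    rw [← h] at hw
    have := (Finset.mem_filter.mp hw).2
    omega
  obtain ⟨F₁, G₁, hF₁, hF₁', hG₁, hG₁', hc⟩ := ih _ hlt (b + 1) (Q.filter fun v => b < v.2.1) rfl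
    (fun u hu => (Finset.mem_filter.mp hu).2) (fun u hu => hle u (hsub hu))
    (fun u hu v hv => hQ u (hsub hu) v (hsub hv))
    ((Finset.card_le_card (Finset.image_subset_image hsub)).trans ht)
  have hF₀b : ∀ u ∈ F₀, u.1 ≤ u.2 ∧ u.2 < b := fun u hu => by
    obtain ⟨a, ha⟩ := hF₀ u hu
    obtain ⟨ha, hab⟩ := Finset.mem_filter.mp ha
    exact ⟨hle _ ha, hab⟩
  have hF₁b : ∀ u ∈ F₁, b < u.1 := fun u hu => by
    obtain ⟨a, ha⟩ := hF₁ u hu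
    exact (Finset.mem_filter.mp ha).2
  have hdisj : Disjoint F₀ F₁ := Finset.disjoint_left.mpr fun u h0 h1 => by
    have := hF₀b u h0
    have := hF₁b u h1
    omega
  have hnot : (lo, b) ∉ G₁ := fun h => by
    have := (hG₁ _ h).1
    dsimp only at this
    omega
  refine ⟨F₀ ∪ F₁, insert (lo, b) G₁, ?_, ?_, ?_, ?_, ?_⟩
  · intro u hu
    rcases Finset.mem_union.mp hu with hu | hu
    · obtain ⟨a, ha⟩ := hF₀ u hu
      exact ⟨a, (Finset.mem_filter.mp ha).1⟩
    · obtain ⟨a, ha⟩ := hF₁ u hu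
      exact ⟨a, (Finset.mem_filter.mp ha).1⟩
  · intro u hu v hv huv
    rcases Finset.mem_union.mp hu with hu | hu <;> rcases Finset.mem_union.mp hv with hv | hv
    · exact hF₀' u hu v hv huv
    · exact Or.inl ((hF₀b u hu).2.trans (hF₁b v hv))
    · exact Or.inr ((hF₀b v hv).2.trans (hF₁b u hu))
    · exact hF₁' u hu v hv huv
  · intro u hu
    rcases Finset.mem_insert.mp hu with rfl | hu
    · refine ⟨le_rfl, by dsimp only; omega, ?_, hbs.trans (Finset.card_le_card
        (Finset.image_subset_image ?_))⟩
      -- If every interval ended before `b`, all would end by `b - 1`, against the minimality of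
      -- `b`.
      · by_contra! hcon
        have h0 := hcon w hw
        dsimp only at h0
        have h1 := Nat.find_min hex (show b - 1 < b by omega)
        rw [Finset.filter_true_of_mem fun v hv => by
          have := hcon v hv
          dsimp only at this
          omega] at h1
        exact h1 hge
      · intro v hv
        obtain ⟨hv, hvb⟩ := Finset.mem_filter.mp hv
        exact Finset.mem_filter.mpr ⟨hv, hlo v hv, hvb⟩
    · obtain ⟨h1, h2, ⟨v, hv, hv'⟩, h3⟩ := hG₁ u hu
      refine ⟨by omega, h2, ⟨v, hsub hv, hv'⟩, h3.trans (Finset.card_le_card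
        (Finset.image_subset_image (Finset.filter_subset_filter _ hsub)))⟩
  · intro u hu v hv huv
    rcases Finset.mem_insert.mp hu with rfl | hu <;> rcases Finset.mem_insert.mp hv with rfl | hv
    · exact absurd rfl huv
    · exact Or.inl (hG₁ v hv).1
    · exact Or.inr (hG₁ u hu).1
    · exact hG₁' u hu v hv huv
  · rw [Finset.card_union_of_disjoint hdisj, Finset.card_insert_of_notMem hnot]
    have hcov : Q ⊆ ((Q.filter fun v => v.2.2 < b) ∪ Q.filter fun v => v.2.1 ≤ b ∧ b ≤ v.2.2) ∪
        Q.filter fun v => b < v.2.1 := by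
      intro v hv
      simp only [Finset.mem_union, Finset.mem_filter, hv, true_and]
      omega
    have h1 := Finset.card_le_card hcov
    have h2 := Finset.card_union_le ((Q.filter fun v => v.2.2 < b) ∪
      Q.filter fun v => v.2.1 ≤ b ∧ b ≤ v.2.2) (Q.filter fun v => b < v.2.1)
    have h3 := Finset.card_union_le (Q.filter fun v => v.2.2 < b)
      (Q.filter fun v => v.2.1 ≤ b ∧ b ≤ v.2.2)
    rw [mul_add, mul_add, mul_one]
    omega

/-- From a family of pairwise disjoint intervals one can select, up to a factor `s + 1`, intervals
that stay disjoint after division by `t`, at the cost of `t + 1` for each block of length `t`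
in which at least `s` intervals of the family lie. -/
theorem exists_intervals_div {α : Type*} [DecidableEq α] (s t : ℕ) (hs : 0 < s) (ht : 0 < t) :
    ∀ (m : ℕ) (Q : Finset (α × ℕ × ℕ)), Q.card = m →
      (∀ u ∈ Q, u.2.1 ≤ u.2.2) →
      (∀ u ∈ Q, ∀ v ∈ Q, u ≠ v → IntervalsDisjoint u.2 v.2) →
    ∃ (F : Finset (ℕ × ℕ)) (W : Finset ℕ),
      (∀ u ∈ F, ∃ v ∈ Q, u = (v.2.1 / t, v.2.2 / t)) ∧
      (∀ u ∈ F, ∀ v ∈ F, u ≠ v → IntervalsDisjoint u v) ∧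
      (∀ c ∈ W, s ≤ (Q.filter fun v => v.2.1 / t = c ∧ v.2.2 / t = c).card) ∧
      Q.card ≤ (s + 1) * F.card + (t + 1) * W.card := by
  intro m
  induction m using Nat.strong_induction_on with
  | _ m ih =>
  intro Q hm hle hQ
  rcases Q.eq_empty_or_nonempty with rfl | hne
  · exact ⟨∅, ∅, by simp⟩
  classical
  obtain ⟨x, hx, hmin⟩ := Finset.exists_min_image Q (fun v => v.2.2) hne
  -- Sweep by blocks: `c` is the block in which the earliest ending interval `x` ends. Intervals
  -- starting in later blocks go to the recursion; the others are paid for by the image of `x` or,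
  -- if block `c` is crowded, by `c`.
  set c := x.2.2 / t with hc
  have hsub : (Q.filter fun v => c < v.2.1 / t) ⊆ Q := Finset.filter_subset _ _
  have hxc : x.2.1 / t ≤ c := Nat.div_le_div_right (hle x hx)
  have hlt : (Q.filter fun v => c < v.2.1 / t).card < m := by
    rw [← hm]
    refine Finset.card_lt_card (Finset.ssubset_iff_subset_ne.mpr ⟨hsub, fun h => ?_⟩)
    rw [← h] at hx
    have := (Finset.mem_filter.mp hx).2
    omega
  obtain ⟨F, W, hF, hF', hW, hcard⟩ := ih _ hlt (Q.filter fun v => c < v.2.1 / t) rfl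
    (fun u hu => hle u (hsub hu)) (fun u hu v hv => hQ u (hsub hu) v (hsub hv))
  have hFc : ∀ u ∈ F, c < u.1 := fun u hu => by
    obtain ⟨v, hv, rfl⟩ := hF u hu
    exact (Finset.mem_filter.mp hv).2
  have hWc : c ∉ W := fun h => by
    obtain ⟨v, hv⟩ := Finset.card_pos.mp (hs.trans_le (hW c h))
    obtain ⟨hv, hv'⟩ := Finset.mem_filter.mp hv
    have := (Finset.mem_filter.mp hv).2
    omega
  have hWs : ∀ c ∈ W, s ≤ (Q.filter fun v => v.2.1 / t = c ∧ v.2.2 / t = c).card := fun c hc =>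
    (hW c hc).trans (Finset.card_le_card (Finset.filter_subset_filter _ hsub))
  have hnot : (x.2.1 / t, c) ∉ F := fun h => by
    have := hFc _ h
    dsimp only at this
    omega
  have hlater : ∀ v ∈ Q, v ≠ x → x.2.2 < v.2.1 := fun v hv hvx => by
    have h1 := hQ x hx v hv hvx.symm
    have h2 := hmin v hv
    have h3 := hle v hv
    have h4 := hle x hx
    unfold IntervalsDisjoint at h1
    omega
  have hsplit : Q.card =
      (Q.filter fun v => c < v.2.1 / t).card + (Q.filter fun v => ¬ c < v.2.1 / t).card :=
    (Finset.card_filter_add_card_filter_not _).symm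
  have hFi : ∀ u ∈ insert (x.2.1 / t, c) F, ∃ v ∈ Q, u = (v.2.1 / t, v.2.2 / t) := by
    intro u hu
    rcases Finset.mem_insert.mp hu with rfl | hu
    · exact ⟨x, hx, rfl⟩
    · obtain ⟨v, hv, h⟩ := hF u hu
      exact ⟨v, hsub hv, h⟩
  have hFd : ∀ u ∈ insert (x.2.1 / t, c) F, ∀ v ∈ insert (x.2.1 / t, c) F, u ≠ v →
      IntervalsDisjoint u v := by
    intro u hu v hv huv
    rcases Finset.mem_insert.mp hu with rfl | hu <;> rcases Finset.mem_insert.mp hv with rfl | hv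
    · exact absurd rfl huv
    · exact Or.inl (hFc v hv)
    · exact Or.inr (hFc u hu)
    · exact hF' u hu v hv huv
  rcases Nat.lt_or_ge (Q.filter fun v => v.2.1 / t = c ∧ v.2.2 / t = c).card s with hcs | hcs
  · refine ⟨insert (x.2.1 / t, c) F, W, hFi, hFd, hWs, ?_⟩
    rw [Finset.card_insert_of_notMem hnot, hsplit]
    -- Only one interval can leave block `c` to the right. With `x` and fewer than `s` inside the
    -- block, the charge is at most `s + 1`.
    have hcr : (Q.filter fun v => v.2.1 / t = c ∧ c < v.2.2 / t).card ≤ 1 := by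
      refine Finset.card_le_one.mpr fun u hu v hv => ?_
      by_contra hne
      obtain ⟨hu, hu1, hu2⟩ := Finset.mem_filter.mp hu
      obtain ⟨hv, hv1, hv2⟩ := Finset.mem_filter.mp hv
      rcases hQ u hu v hv hne with h | h
      · have := Nat.div_le_div_right (c := t) h.le
        omega
      · have := Nat.div_le_div_right (c := t) h.le
        omega
    have hcov : (Q.filter fun v => ¬ c < v.2.1 / t) ⊆
        {x} ∪ ((Q.filter fun v => v.2.1 / t = c ∧ v.2.2 / t = c) ∪
          Q.filter fun v => v.2.1 / t = c ∧ c < v.2.2 / t) := by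
      intro v hv
      obtain ⟨hv, hvc⟩ := Finset.mem_filter.mp hv
      simp only [Finset.mem_union, Finset.mem_singleton, Finset.mem_filter, hv, true_and]
      by_cases hvx : v = x
      · exact Or.inl hvx
      · have h1 := Nat.div_le_div_right (c := t) (hlater v hv hvx).le
        have h2 := Nat.div_le_div_right (c := t) (hle v hv)
        omega
    have h1 := Finset.card_le_card hcov
    have h2 := Finset.card_union_le {x} ((Q.filter fun v => v.2.1 / t = c ∧ v.2.2 / t = c) ∪
          Q.filter fun v => v.2.1 / t = c ∧ c < v.2.2 / t)
    have h3 := Finset.card_union_le (Q.filter fun v => v.2.1 / t = c ∧ v.2.2 / t = c)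
          (Q.filter fun v => v.2.1 / t = c ∧ c < v.2.2 / t)
    rw [Finset.card_singleton] at h2
    rw [mul_add, mul_one]
    omega
  · refine ⟨F, insert c W, fun u hu => hFi u (Finset.mem_insert_of_mem hu), hF', ?_, ?_⟩
    · intro c' hc'
      rcases Finset.mem_insert.mp hc' with rfl | hc'
      · exact hcs
      · exact hWs c' hc'
    · rw [Finset.card_insert_of_notMem hWc, hsplit]
      have hcov : (Q.filter fun v => ¬ c < v.2.1 / t) ⊆
          {x} ∪ Q.filter fun v => v.2.1 / t = c := by
        intro v hv
        obtain ⟨hv, hvc⟩ := Finset.mem_filter.mp hv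
        simp only [Finset.mem_union, Finset.mem_singleton, Finset.mem_filter, hv, true_and]
        by_cases hvx : v = x
        · exact Or.inl hvx
        · have h1 := Nat.div_le_div_right (c := t) (hlater v hv hvx).le
          omega
      -- Disjoint intervals have distinct left ends, and a block has `t` positions.
      have hcr : (Q.filter fun v => v.2.1 / t = c).card ≤ t := by
        calc _ ≤ (Finset.Ico (c * t) (c * t + t)).card := by
              refine Finset.card_le_card_of_injOn (fun v => v.2.1) ?_ ?_
              · intro v hv
                have := (Finset.mem_filter.mp hv).2
                rw [Nat.div_eq_iff ht] at this
                simp only [Finset.coe_Ico, Set.mem_Ico]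
                omega
              · intro u hu v hv huv
                by_contra hne
                obtain ⟨hu, -⟩ := Finset.mem_filter.mp hu
                obtain ⟨hv, -⟩ := Finset.mem_filter.mp hv
                have h1 := hQ u hu v hv hne
                have h2 := hle u hu
                have h3 := hle v hv
                unfold IntervalsDisjoint at h1
                dsimp only at huv
                omega
          _ = t := by simp
      have h1 := Finset.card_le_card hcov
      have h2 := Finset.card_union_le {x} (Q.filter fun v => v.2.1 / t = c)
      rw [Finset.card_singleton] at h2
      rw [mul_add, mul_one]
      omega

/-! ### Segment families and their minors -/

/-- A finite family of intervals `[s.2.1, s.2.2]` in `{0, …, N - 1}`, each placed on a line `s.1` of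
the grid `∏ i ∈ T, {0, …, n i - 1}`, such that intervals on the same line are disjoint. -/
structure IsSegmentFamily {ι : Type*} (T : Finset ι) (n : ι → ℕ) (N : ℕ)
    (S : Finset ((ι → ℕ) × ℕ × ℕ)) : Prop where
  eq_zero : ∀ s ∈ S, ∀ i ∉ T, s.1 i = 0
  lt : ∀ s ∈ S, ∀ i ∈ T, s.1 i < n i
  le : ∀ s ∈ S, s.2.1 ≤ s.2.2
  lt_bound : ∀ s ∈ S, s.2.2 < N
  disjoint : ∀ s ∈ S, ∀ s' ∈ S, s.1 = s'.1 → s ≠ s' → IntervalsDisjoint s.2 s'.2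

/-- There are `k` consecutive intervals in each direction of `T` and `k` consecutive intervals in
the direction of the segments such that each of the resulting boxes contains a whole segment. -/
def HasSegmentMinor {ι : Type*} (T : Finset ι) (k : ℕ) (S : Finset ((ι → ℕ) × ℕ × ℕ)) : Prop :=
  ∃ (c : ι → ℕ → ℕ) (e : ℕ → ℕ), (∀ i, Monotone (c i)) ∧ Monotone e ∧
    ∀ z : ι → ℕ, (∀ i ∈ T, z i < k) → ∀ r < k, ∃ s ∈ S,
      (∀ i ∈ T, c i (z i) ≤ s.1 i ∧ s.1 i < c i (z i + 1)) ∧ e r ≤ s.2.1 ∧ s.2.2 < e (r + 1)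

theorem IsSegmentFamily.mono {ι : Type*} {T : Finset ι} {n n' : ι → ℕ} {N N' : ℕ}
    {S : Finset ((ι → ℕ) × ℕ × ℕ)} (h : IsSegmentFamily T n N S) (hn : ∀ i ∈ T, n i ≤ n' i)
    (hN : N ≤ N') : IsSegmentFamily T n' N' S :=
  ⟨h.eq_zero, fun s hs i hi => (h.lt s hs i hi).trans_le (hn i hi), h.le,
    fun s hs => (h.lt_bound s hs).trans_le hN, h.disjoint⟩

theorem exists_finset_sigma {β γ : Type*} [DecidableEq β] [DecidableEq γ] (B : Finset β)
    (f : β → Finset γ) :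
    ∃ F : Finset (β × γ), (∀ b g, (b, g) ∈ F ↔ b ∈ B ∧ g ∈ f b) ∧
      F.card = ∑ b ∈ B, (f b).card := by
  refine ⟨(B.sigma f).map (Equiv.sigmaEquivProd β γ).toEmbedding, fun b g => ?_, by simp⟩
  rw [Finset.mem_map_equiv]
  simp

theorem exists_cuts_of_disjoint (k : ℕ) : ∀ (B : ℕ) (S : Finset (ℕ × ℕ)), k ≤ S.card →
    (∀ u ∈ S, u.1 ≤ u.2) → (∀ u ∈ S, u.2 < B) →
    (∀ u ∈ S, ∀ v ∈ S, u ≠ v → IntervalsDisjoint u v) →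
    ∃ e : ℕ → ℕ, Monotone e ∧ (∀ r, e r ≤ B) ∧
      ∀ r < k, ∃ u ∈ S, e r ≤ u.1 ∧ u.2 < e (r + 1) := by
  induction k with
  | zero => exact fun B S _ _ _ _ => ⟨fun _ => 0, monotone_const, by simp, by simp⟩
  | succ k ih =>
    intro B S hk hle hB hS
    obtain ⟨x, hx, hmax⟩ := Finset.exists_max_image S (fun u => u.1)
      (Finset.card_pos.mp (by omega))
    have hlt : ∀ u ∈ S.erase x, u.2 < x.1 := fun u hu => by
      have h1 := hS u (Finset.mem_of_mem_erase hu) x hx (Finset.ne_of_mem_erase hu)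
      have h2 := hmax u (Finset.mem_of_mem_erase hu)
      have h3 := hle x hx
      have h4 := hle u (Finset.mem_of_mem_erase hu)
      unfold IntervalsDisjoint at h1
      omega
    obtain ⟨e, he, heB, hek⟩ := ih x.1 (S.erase x)
      (by rw [Finset.card_erase_of_mem hx]; omega)
      (fun u hu => hle u (Finset.mem_of_mem_erase hu)) hlt
      fun u hu v hv => hS u (Finset.mem_of_mem_erase hu) v (Finset.mem_of_mem_erase hv)
    have hxB := hB x hx
    have hxle := hle x hx
    refine ⟨fun r => if r ≤ k then e r else B, ?_, ?_, ?_⟩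
    · intro r r' hr
      have h1 := he hr
      have h2 := heB r
      dsimp only
      split_ifs <;> omega
    · intro r
      have h2 := heB r
      dsimp only
      split_ifs <;> omega
    · intro r hr
      rcases Nat.lt_or_ge r k with hrk | hrk
      · obtain ⟨u, hu, h1, h2⟩ := hek r hrk
        refine ⟨u, Finset.mem_of_mem_erase hu, ?_⟩
        simp only [hrk.le, if_true, Nat.succ_le_of_lt hrk]
        exact ⟨h1, h2⟩
      · obtain rfl : r = k := by omega
        refine ⟨x, hx, ?_⟩
        simpa using ⟨heB r, hxB⟩

/-- Base of the induction on dimension: all segments lie on one line, hence are disjoint, and any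
`k` of them can be separated by cuts. -/
theorem card_le_of_not_hasSegmentMinor_empty {ι : Type*} {k N : ℕ} {n : ι → ℕ}
    {S : Finset ((ι → ℕ) × ℕ × ℕ)} (hS : IsSegmentFamily ∅ n N S)
    (hno : ¬ HasSegmentMinor ∅ k S) : S.card ≤ k := by
  classical
  by_contra! hlt
  have h1 : ∀ s ∈ S, s.1 = 0 := fun s hs => funext fun i => hS.eq_zero s hs i (by simp)
  refine hno ?_
  obtain ⟨e, he, -, hek⟩ := exists_cuts_of_disjoint k N (S.image Prod.snd) (by
      rw [Finset.card_image_of_injOn fun u hu v hv h => Prod.ext ((h1 u hu).trans (h1 v hv).symm) h]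
      exact hlt.le) (by
      simp only [Finset.mem_image]
      rintro _ ⟨s, hs, rfl⟩
      exact hS.le s hs) (by
      simp only [Finset.mem_image]
      rintro _ ⟨s, hs, rfl⟩
      exact hS.lt_bound s hs) (by
      simp only [Finset.mem_image]
      rintro _ ⟨s, hs, rfl⟩ _ ⟨s', hs', rfl⟩ hne
      exact hS.disjoint s hs s' hs' ((h1 s hs).trans (h1 s' hs').symm) fun h => hne (by rw [h]))
  refine ⟨fun _ _ => 0, e, fun _ => monotone_const, he, fun z _ r hr => ?_⟩
  obtain ⟨u, hu, h⟩ := hek r hr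
  obtain ⟨s, hs, rfl⟩ := Finset.mem_image.mp hu
  exact ⟨s, hs, by simp, h⟩

/-! ### Contracting one direction -/

/-- Contraction of a segment family by a factor `2 ^ τ` in a direction `i` across the segments. -/
theorem exists_contract_transverse {ι : Type*} [DecidableEq ι] {T : Finset ι} {n : ι → ℕ} {N : ℕ}
    {S : Finset ((ι → ℕ) × ℕ × ℕ)} (hS : IsSegmentFamily T n N S) {i : ι} (hi : i ∈ T)
    {k l τ n' M : ℕ} (hkl : k ≤ l + 1) (hn : n i ≤ 2 ^ τ * n') (hno : ¬ HasSegmentMinor T k S)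
    (hM : ∀ S', IsSegmentFamily (T.erase i) n N S' → ¬ HasSegmentMinor (T.erase i) k S' →
      S'.card ≤ M) :
    ∃ S', IsSegmentFamily T (Function.update n i n') N S' ∧ ¬ HasSegmentMinor T k S' ∧
      S.card ≤ 2 ^ l * S'.card + 2 ^ τ * (n' * (M * (2 ^ τ * 2 ^ τ))) := by
  classical
  have ht : 0 < 2 ^ τ := by positivity
  set t := 2 ^ τ with htdef
  -- `κ` merges `t` neighbouring lines. Segments from different lines may overlap after merging, so
  -- the lines serve as labels when disjoint segments are selected.
  let κ : (ι → ℕ) → ι → ℕ := fun y => Function.update y i (y i / t)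
  have hκi : ∀ y, κ y i = y i / t := fun y => by simp [κ]
  have hκj : ∀ y, ∀ j ≠ i, κ y j = y j := fun y j hj => by simp [κ, hj]
  have hκinj : ∀ y y', κ y = κ y' → y i = y' i → y = y' := fun y y' h h' => funext fun j => by
    by_cases hj : j = i
    · rw [hj, h']
    · rw [← hκj y j hj, h, hκj y' j hj]
  let B := S.image fun s => κ s.1
  let Q : (ι → ℕ) → Finset ((ι → ℕ) × ℕ × ℕ) := fun Y => S.filter fun s => κ s.1 = Y
  have hQS : ∀ Y, ∀ s ∈ Q Y, s ∈ S ∧ κ s.1 = Y := fun Y s hs => Finset.mem_filter.mp hs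
  have hlines : ∀ Y, ((Q Y).image Prod.fst).card ≤ t := fun Y => by
    calc _ ≤ (Finset.Ico (Y i * t) (Y i * t + t)).card := by
          refine Finset.card_le_card_of_injOn (fun y => y i) ?_ ?_
          · intro y hy
            obtain ⟨s, hs, rfl⟩ := Finset.mem_image.mp hy
            obtain ⟨-, rfl⟩ := hQS Y s hs
            have h := hκi s.1
            rw [eq_comm, Nat.div_eq_iff ht] at h
            simp only [Finset.coe_Ico, Set.mem_Ico]
            omega
          · intro y hy y' hy' h
            obtain ⟨s, hs, rfl⟩ := Finset.mem_image.mp hy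
            obtain ⟨s', hs', rfl⟩ := Finset.mem_image.mp hy'
            exact hκinj _ _ ((hQS Y s hs).2.trans (hQS Y s' hs').2.symm) h
      _ = t := by simp
  choose F G hF hF' hG hG' hFG using fun Y => exists_intervals_groups (2 ^ l) t (by positivity) _ 0
    (Q Y) rfl (by simp) (fun s hs => hS.le s (hQS Y s hs).1)
    (fun s hs s' hs' => hS.disjoint s (hQS Y s hs).1 s' (hQS Y s' hs').1) (hlines Y)
  obtain ⟨S', hS', hS'card⟩ := exists_finset_sigma B F
  obtain ⟨S'', hS'', hS''card⟩ := exists_finset_sigma B G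
  have hB : ∀ Y ∈ B, (∀ j ∉ T, Y j = 0) ∧ (∀ j ∈ T, Y j < Function.update n i n' j) := by
    intro Y hY
    obtain ⟨s, hs, rfl⟩ := Finset.mem_image.mp hY
    refine ⟨fun j hj => ?_, fun j hj => ?_⟩
    · rw [hκj _ j (by rintro rfl; exact hj hi)]
      exact hS.eq_zero s hs j hj
    · by_cases hji : j = i
      · subst hji
        rw [hκi, Function.update_self, Nat.div_lt_iff_lt_mul ht, mul_comm]
        exact (hS.lt s hs j hj).trans_le hn
      · rw [hκj _ j hji, Function.update_of_ne hji]
        exact hS.lt s hs j hj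
  refine ⟨S', ⟨fun s hs => (hB s.1 ((hS' s.1 s.2).mp hs).1).1,
    fun s hs => (hB s.1 ((hS' s.1 s.2).mp hs).1).2, ?_, ?_, ?_⟩, ?_, ?_⟩
  · intro s hs
    obtain ⟨a, ha⟩ := hF _ _ ((hS' s.1 s.2).mp hs).2
    exact hS.le (a, s.2) (hQS _ _ ha).1
  · intro s hs
    obtain ⟨a, ha⟩ := hF _ _ ((hS' s.1 s.2).mp hs).2
    exact hS.lt_bound (a, s.2) (hQS _ _ ha).1
  · intro s hs s' hs' h hne
    have h1 := ((hS' s.1 s.2).mp hs).2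
    have h2 := ((hS' s'.1 s'.2).mp hs').2
    rw [← h] at h2
    exact hF' _ _ h1 _ h2 fun h' => hne (Prod.ext h h')
  · rintro ⟨c, e, hc, he, h⟩
    -- The selected segments are original ones, so a minor after merging lifts by scaling the cuts
    -- in direction `i` by `t`.
    refine hno ⟨Function.update c i fun r => t * c i r, e, fun j => ?_, he, fun z hz r hr => ?_⟩
    · by_cases hji : j = i
      · subst hji
        rw [Function.update_self]
        exact fun a b hab => Nat.mul_le_mul_left _ (hc j hab)
      · rw [Function.update_of_ne hji]
        exact hc j
    · obtain ⟨s, hs, h1, h2⟩ := h z hz r hr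
      obtain ⟨a, ha⟩ := hF _ _ ((hS' s.1 s.2).mp hs).2
      obtain ⟨haS, haκ⟩ := hQS _ _ ha
      refine ⟨_, haS, fun j hj => ?_, h2⟩
      have h3 := h1 j hj
      rw [← haκ] at h3
      by_cases hji : j = i
      · subst hji
        rw [hκi, Nat.le_div_iff_mul_le ht, Nat.div_lt_iff_lt_mul ht] at h3
        rw [Function.update_self]
        dsimp only at h3 ⊢
        rwa [mul_comm t, mul_comm t]
      · rw [hκj _ j hji] at h3
        rw [Function.update_of_ne hji]
        exact h3
  · have hScard : S.card = ∑ Y ∈ B, (Q Y).card :=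
      Finset.card_eq_sum_card_fiberwise fun s hs => Finset.mem_image_of_mem _ hs
    have hle : S.card ≤ 2 ^ l * S'.card + t * S''.card := by
      rw [hScard, hS'card, hS''card, Finset.mul_sum, Finset.mul_sum, ← Finset.sum_add_distrib]
      exact Finset.sum_le_sum fun Y _ => hFG Y
    refine hle.trans (Nat.add_le_add_left (Nat.mul_le_mul_left _ ?_) _)
    -- It remains to bound the crowded groups slab by slab, at most `M * (t * t)` in each slab of
    -- width `t` in direction `i`.
    have hfib : S''.card = ∑ c ∈ Finset.range n', (S''.filter fun s => s.1 i = c).card := by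
      refine Finset.card_eq_sum_card_fiberwise fun s hs => ?_
      have h := (hB s.1 ((hS'' s.1 s.2).mp hs).1).2 i hi
      simpa using h
    rw [hfib]
    refine (Finset.sum_le_card_nsmul _ _ (M * (t * t)) fun c hc => ?_).trans (by simp)
    by_contra! hbig
    -- The points attached to a group are the `i`-coordinates of the original lines having a segment
    -- inside it.
    let P : (ι → ℕ) × ℕ × ℕ → Finset ℕ := fun s =>
      (((Q s.1).filter fun v => s.2.1 ≤ v.2.1 ∧ v.2.2 ≤ s.2.2).image Prod.fst).image fun y => y i
    obtain ⟨U, hU, hUM, c', hc', -, hcP⟩ := exists_common_cuts M τ P l (c * t)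
      (S''.filter fun s => s.1 i = c) (by
        intro s hs x hx
        obtain ⟨-, hsc⟩ := Finset.mem_filter.mp hs
        simp only [P, Finset.mem_image, Finset.mem_filter] at hx
        obtain ⟨_, ⟨v, ⟨hv, -⟩, rfl⟩, rfl⟩ := hx
        have h := hκi v.1
        rw [(hQS _ _ hv).2, hsc, eq_comm, Nat.div_eq_iff ht] at h
        omega) (by
        intro s hs
        obtain ⟨hs, hsc⟩ := Finset.mem_filter.mp hs
        refine ((hG _ _ ((hS'' s.1 s.2).mp hs).2).2.2.2).trans (le_of_eq ?_)
        refine (Finset.card_image_of_injOn ?_).symm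
        intro y hy y' hy' h
        obtain ⟨v, hv, rfl⟩ := Finset.mem_image.mp hy
        obtain ⟨v', hv', rfl⟩ := Finset.mem_image.mp hy'
        exact hκinj _ _ ((hQS _ v (Finset.mem_filter.mp hv).1).2.trans
          (hQS _ v' (Finset.mem_filter.mp hv').1).2.symm) h) (by
        refine lt_of_le_of_lt (Nat.mul_le_mul_left _ (Nat.mul_le_mul_left _ ?_)) hbig
        exact Nat.choose_le_two_pow _ _)
    have hUS : ∀ s ∈ U, s ∈ S'' ∧ s.1 i = c := fun s hs => Finset.mem_filter.mp (hU hs)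
    -- Groups of one slab share coordinate `i`, so it can be forgotten: the groups themselves become
    -- segments in one direction fewer.
    let π : (ι → ℕ) × ℕ × ℕ → (ι → ℕ) × ℕ × ℕ := fun s => (Function.update s.1 i 0, s.2)
    have hπ : ∀ s ∈ U, ∀ s' ∈ U, (π s).1 = (π s').1 → s.1 = s'.1 := by
      intro s hs s' hs' h
      funext j
      by_cases hji : j = i
      · rw [hji, (hUS s hs).2, (hUS s' hs').2]
      · simpa [π, hji] using congrFun h j
    have hcardU : (U.image π).card = U.card := Finset.card_image_of_injOn fun s hs s' hs' h =>
      Prod.ext (hπ s hs s' hs' (congrArg Prod.fst h)) (congrArg (fun w => w.2) h)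
    have hfam : IsSegmentFamily (T.erase i) n N (U.image π) := by
      refine ⟨?_, ?_, ?_, ?_, ?_⟩
      · intro s hs j hj
        obtain ⟨u, hu, rfl⟩ := Finset.mem_image.mp hs
        by_cases hji : j = i
        · simp [π, hji]
        · simp only [π, Function.update_of_ne hji]
          exact (hB _ ((hS'' u.1 u.2).mp (hUS u hu).1).1).1 j fun h =>
            hj (Finset.mem_erase.mpr ⟨hji, h⟩)
      · intro s hs j hj
        obtain ⟨u, hu, rfl⟩ := Finset.mem_image.mp hs
        obtain ⟨hji, hj⟩ := Finset.mem_erase.mp hj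
        have h := (hB _ ((hS'' u.1 u.2).mp (hUS u hu).1).1).2 j hj
        rw [Function.update_of_ne hji] at h
        simpa only [π, Function.update_of_ne hji] using h
      · intro s hs
        obtain ⟨u, hu, rfl⟩ := Finset.mem_image.mp hs
        exact (hG _ _ ((hS'' u.1 u.2).mp (hUS u hu).1).2).2.1
      · intro s hs
        obtain ⟨u, hu, rfl⟩ := Finset.mem_image.mp hs
        obtain ⟨v, hv, hv'⟩ := (hG _ _ ((hS'' u.1 u.2).mp (hUS u hu).1).2).2.2.1
        exact lt_of_le_of_lt hv' (hS.lt_bound v (hQS _ v hv).1)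
      · intro s hs s' hs' h hne
        obtain ⟨u, hu, rfl⟩ := Finset.mem_image.mp hs
        obtain ⟨u', hu', rfl⟩ := Finset.mem_image.mp hs'
        have h1 := ((hS'' u.1 u.2).mp (hUS u hu).1).2
        have h2 := ((hS'' u'.1 u'.2).mp (hUS u' hu').1).2
        have h3 := hπ u hu u' hu' h
        rw [← h3] at h2
        exact hG' _ _ h1 _ h2 fun h' => hne (by rw [Prod.ext h3 h'])
    obtain ⟨d, e, hd, he, hde⟩ : HasSegmentMinor (T.erase i) k (U.image π) := by
      by_contra hcon
      have := hM _ hfam hcon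
      omega
    refine hno ⟨Function.update d i c', e, fun j => ?_, he, fun z hz r hr => ?_⟩
    · by_cases hji : j = i
      · subst hji
        rwa [Function.update_self]
      · rw [Function.update_of_ne hji]
        exact hd j
    · obtain ⟨s, hs, h1, h2⟩ := hde z (fun j hj => hz j (Finset.mem_of_mem_erase hj)) r hr
      obtain ⟨u, hu, rfl⟩ := Finset.mem_image.mp hs
      -- In the group found for the other directions, the common cuts supply an original line in the
      -- prescribed part of the slab; its segment lies within the group and thus between the same
      -- cuts `e`.
      obtain ⟨x, hx, hx'⟩ := hcP u hu (z i) (by have := hz i hi; omega)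
      simp only [P, Finset.mem_image, Finset.mem_filter] at hx
      obtain ⟨_, ⟨v, ⟨hv, hvs⟩, rfl⟩, rfl⟩ := hx
      obtain ⟨hvS, hvκ⟩ := hQS _ _ hv
      refine ⟨v, hvS, fun j hj => ?_, ?_⟩
      · by_cases hji : j = i
        · subst hji
          rwa [Function.update_self]
        · rw [Function.update_of_ne hji, ← hκj v.1 j hji, hvκ]
          simpa only [π, Function.update_of_ne hji] using h1 j (Finset.mem_erase.mpr ⟨hji, hj⟩)
      · simp only [π] at h2
        omega

/-- Contraction of a segment family by a factor `2 ^ τ` in the direction of the segments. -/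
theorem exists_contract_longitudinal {ι : Type*} [DecidableEq ι] {T : Finset ι} {n : ι → ℕ}
    {N : ℕ} {S : Finset ((ι → ℕ) × ℕ × ℕ)} (hS : IsSegmentFamily T n N S) {i : ι} (hi : i ∈ T)
    {k l τ N' M : ℕ} (hkl : 2 * k ≤ l + 1) (hN : N ≤ 2 ^ τ * N') (hno : ¬ HasSegmentMinor T k S)
    (hM : ∀ S', IsSegmentFamily (T.erase i) n (n i) S' → ¬ HasSegmentMinor (T.erase i) k S' →
      S'.card ≤ M) :
    ∃ S', IsSegmentFamily T n N' S' ∧ ¬ HasSegmentMinor T k S' ∧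
      S.card ≤ (2 ^ l + 1) * S'.card + (2 ^ τ + 1) * (N' * (M * (2 ^ τ * 2 ^ τ))) := by
  classical
  have ht : 0 < 2 ^ τ := by positivity
  set t := 2 ^ τ with htdef
  let B := S.image Prod.fst
  let Q : (ι → ℕ) → Finset ((ι → ℕ) × ℕ × ℕ) := fun y => S.filter fun s => s.1 = y
  have hQS : ∀ y, ∀ s ∈ Q y, s ∈ S ∧ s.1 = y := fun y s hs => Finset.mem_filter.mp hs
  choose F W hF hF' hW hFW using fun y => exists_intervals_div (2 ^ l) t (by positivity) ht _
    (Q y) rfl (fun s hs => hS.le s (hQS y s hs).1)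
    (fun s hs s' hs' => hS.disjoint s (hQS y s hs).1 s' (hQS y s' hs').1
      ((hQS y s hs).2.trans (hQS y s' hs').2.symm))
  obtain ⟨S', hS', hS'card⟩ := exists_finset_sigma B F
  obtain ⟨V, hV, hVcard⟩ := exists_finset_sigma B W
  have hB : ∀ y ∈ B, (∀ j ∉ T, y j = 0) ∧ (∀ j ∈ T, y j < n j) := by
    intro y hy
    obtain ⟨s, hs, rfl⟩ := Finset.mem_image.mp hy
    exact ⟨hS.eq_zero s hs, hS.lt s hs⟩
  have hdivN : ∀ s ∈ S, s.2.2 / t < N' := fun s hs => by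
    rw [Nat.div_lt_iff_lt_mul ht, mul_comm]
    exact (hS.lt_bound s hs).trans_le hN
  refine ⟨S', ⟨fun s hs => (hB s.1 ((hS' s.1 s.2).mp hs).1).1,
    fun s hs => (hB s.1 ((hS' s.1 s.2).mp hs).1).2, ?_, ?_, ?_⟩, ?_, ?_⟩
  · intro s hs
    obtain ⟨v, hv, h⟩ := hF _ _ ((hS' s.1 s.2).mp hs).2
    rw [h]
    exact Nat.div_le_div_right (hS.le v (hQS _ _ hv).1)
  · intro s hs
    obtain ⟨v, hv, h⟩ := hF _ _ ((hS' s.1 s.2).mp hs).2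
    rw [h]
    exact hdivN v (hQS _ _ hv).1
  · intro s hs s' hs' h hne
    have h1 := ((hS' s.1 s.2).mp hs).2
    have h2 := ((hS' s'.1 s'.2).mp hs').2
    rw [← h] at h2
    exact hF' _ _ h1 _ h2 fun h' => hne (Prod.ext h h')
  · rintro ⟨c, e, hc, he, h⟩
    refine hno ⟨c, fun r => e r * t, hc, fun a b hab => Nat.mul_le_mul_right _ (he hab),
      fun z hz r hr => ?_⟩
    obtain ⟨s, hs, h1, h2⟩ := h z hz r hr
    obtain ⟨v, hv, h3⟩ := hF _ _ ((hS' s.1 s.2).mp hs).2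
    rw [h3, Nat.le_div_iff_mul_le ht, Nat.div_lt_iff_lt_mul ht] at h2
    obtain ⟨hvS, hvy⟩ := hQS _ _ hv
    exact ⟨v, hvS, by rwa [hvy], h2⟩
  · have hScard : S.card = ∑ y ∈ B, (Q y).card :=
      Finset.card_eq_sum_card_fiberwise fun s hs => Finset.mem_image_of_mem _ hs
    have hle : S.card ≤ (2 ^ l + 1) * S'.card + (t + 1) * V.card := by
      rw [hScard, hS'card, hVcard, Finset.mul_sum, Finset.mul_sum, ← Finset.sum_add_distrib]
      exact Finset.sum_le_sum fun y _ => hFW y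
    refine hle.trans (Nat.add_le_add_left (Nat.mul_le_mul_left _ ?_) _)
    -- Here a slab consists of the crowded blocks with the same longitudinal position `c`.
    have hfib : V.card = ∑ c ∈ Finset.range N', (V.filter fun s => s.2 = c).card := by
      refine Finset.card_eq_sum_card_fiberwise fun s hs => ?_
      obtain ⟨v, hv⟩ := Finset.card_pos.mp
        (lt_of_lt_of_le (by positivity) (hW _ _ ((hV s.1 s.2).mp hs).2))
      obtain ⟨hv, -, hv'⟩ := Finset.mem_filter.mp hv
      have h := hdivN v (hQS _ _ hv).1
      simpa [hv'] using h
    rw [hfib]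
    refine (Finset.sum_le_card_nsmul _ _ (M * (t * t)) fun c hc => ?_).trans (by simp)
    by_contra! hbig
    let P : (ι → ℕ) × ℕ → Finset ℕ := fun s =>
      ((Q s.1).filter fun v => v.2.1 / t = c ∧ v.2.2 / t = c).image fun v => v.2.1
    obtain ⟨U, hU, hUM, c', hc', -, hcP⟩ := exists_common_cuts M τ P l (c * t)
      (V.filter fun s => s.2 = c) (by
        intro s hs x hx
        obtain ⟨v, hv, rfl⟩ := Finset.mem_image.mp hx
        have h := (Finset.mem_filter.mp hv).2.1
        rw [Nat.div_eq_iff ht] at h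
        omega) (by
        intro s hs
        obtain ⟨hs, hsc⟩ := Finset.mem_filter.mp hs
        have h := hW _ _ ((hV s.1 s.2).mp hs).2
        rw [hsc] at h
        refine h.trans (le_of_eq (Finset.card_image_of_injOn ?_).symm)
        intro v hv v' hv' hvv
        by_contra hne
        obtain ⟨hv, -⟩ := Finset.mem_filter.mp hv
        obtain ⟨hv', -⟩ := Finset.mem_filter.mp hv'
        obtain ⟨hv, hvy⟩ := hQS _ _ hv
        obtain ⟨hv', hvy'⟩ := hQS _ _ hv'
        have h1 := hS.disjoint v hv v' hv' (hvy.trans hvy'.symm) hne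
        have h2 := hS.le v hv
        have h3 := hS.le v' hv'
        unfold IntervalsDisjoint at h1
        dsimp only at hvv
        omega) (by
        refine lt_of_le_of_lt (Nat.mul_le_mul_left _ (Nat.mul_le_mul_left _ ?_)) hbig
        exact Nat.choose_le_two_pow _ _)
    have hUV : ∀ s ∈ U, s ∈ V ∧ s.2 = c := fun s hs => Finset.mem_filter.mp (hU hs)
    -- The longitudinal position is constant in the slab and is dropped. Direction `i` takes over as
    -- the segment direction, with segments of a single point.
    let π : (ι → ℕ) × ℕ → (ι → ℕ) × ℕ × ℕ := fun s =>
      (Function.update s.1 i 0, s.1 i, s.1 i)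
    have hπ : ∀ s ∈ U, ∀ s' ∈ U, (π s).1 = (π s').1 → s.1 i = s'.1 i → s = s' := by
      intro s hs s' hs' h h'
      refine Prod.ext (funext fun j => ?_) ((hUV s hs).2.trans (hUV s' hs').2.symm)
      by_cases hji : j = i
      · rw [hji, h']
      · simpa [π, hji] using congrFun h j
    have hcardU : (U.image π).card = U.card := Finset.card_image_of_injOn fun s hs s' hs' h =>
      hπ s hs s' hs' (congrArg Prod.fst h) (congrArg (fun w => w.2.1) h)
    have hUB : ∀ s ∈ U, s.1 ∈ B := fun s hs => ((hV s.1 s.2).mp (hUV s hs).1).1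
    have hfam : IsSegmentFamily (T.erase i) n (n i) (U.image π) := by
      refine ⟨?_, ?_, ?_, ?_, ?_⟩
      · intro s hs j hj
        obtain ⟨u, hu, rfl⟩ := Finset.mem_image.mp hs
        by_cases hji : j = i
        · simp [π, hji]
        · simp only [π, Function.update_of_ne hji]
          exact (hB _ (hUB u hu)).1 j fun h => hj (Finset.mem_erase.mpr ⟨hji, h⟩)
      · intro s hs j hj
        obtain ⟨u, hu, rfl⟩ := Finset.mem_image.mp hs
        obtain ⟨hji, hj⟩ := Finset.mem_erase.mp hj
        simpa only [π, Function.update_of_ne hji] using (hB _ (hUB u hu)).2 j hj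
      · intro s hs
        obtain ⟨u, hu, rfl⟩ := Finset.mem_image.mp hs
        exact le_rfl
      · intro s hs
        obtain ⟨u, hu, rfl⟩ := Finset.mem_image.mp hs
        exact (hB _ (hUB u hu)).2 i hi
      · intro s hs s' hs' h hne
        obtain ⟨u, hu, rfl⟩ := Finset.mem_image.mp hs
        obtain ⟨u', hu', rfl⟩ := Finset.mem_image.mp hs'
        exact lt_or_gt_of_ne fun h' => hne (by rw [hπ u hu u' hu' h h'])
    obtain ⟨d, e, hd, he, hde⟩ : HasSegmentMinor (T.erase i) k (U.image π) := by
      by_contra hcon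
      have := hM _ hfam hcon
      omega
    -- The cuts `e` return to direction `i`. Along the segments every second common cut is used: a
    -- segment starting in interval `2 * r` ends before the one starting in interval `2 * r + 1`, so
    -- it fits in the doubled interval. Hence the hypothesis `2 * k ≤ l + 1`.
    refine hno ⟨Function.update d i e, fun r => c' (2 * r), fun j => ?_,
      fun a b hab => hc' (by omega), fun z hz r hr => ?_⟩
    · by_cases hji : j = i
      · subst hji
        rwa [Function.update_self]
      · rw [Function.update_of_ne hji]
        exact hd j
    · obtain ⟨s, hs, h1, h2⟩ :=
        hde z (fun j hj => hz j (Finset.mem_of_mem_erase hj)) (z i) (hz i hi)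
      obtain ⟨u, hu, rfl⟩ := Finset.mem_image.mp hs
      obtain ⟨x, hx, hx'⟩ := hcP u hu (2 * r) (by omega)
      obtain ⟨x₂, hx₂, hx₂'⟩ := hcP u hu (2 * r + 1) (by omega)
      obtain ⟨v, hv, rfl⟩ := Finset.mem_image.mp hx
      obtain ⟨v₂, hv₂, rfl⟩ := Finset.mem_image.mp hx₂
      obtain ⟨hvS, hvy⟩ := hQS _ _ (Finset.mem_filter.mp hv).1
      obtain ⟨hvS₂, hvy₂⟩ := hQS _ _ (Finset.mem_filter.mp hv₂).1
      refine ⟨v, hvS, fun j hj => ?_, hx'.1, ?_⟩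
      · rw [hvy]
        by_cases hji : j = i
        · subst hji
          rwa [Function.update_self]
        · rw [Function.update_of_ne hji]
          simpa only [π, Function.update_of_ne hji] using h1 j (Finset.mem_erase.mpr ⟨hji, hj⟩)
      · have h3 := hS.disjoint v hvS v₂ hvS₂ (hvy.trans hvy₂.symm) (by rintro rfl; omega)
        have h4 := hS.le v₂ hvS₂
        have h5 := hS.le v hvS
        unfold IntervalsDisjoint at h3
        change v.2.2 < c' (2 * r + 1 + 1)
        omega

/-! ### Induction on scale and on dimension -/

/-- Each of the `T.card + 1` single contractions multiplies the size by at most `2 ^ (2 * k)` and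
adds one error term. The bound `M` at full scale serves at every stage, because partly contracted
families still fit in the full grid. -/
theorem exists_contract {ι : Type*} [DecidableEq ι] {T : Finset ι} {n k τ M : ℕ} (hk : 1 ≤ k)
    (hT : T.Nonempty) {S : Finset ((ι → ℕ) × ℕ × ℕ)}
    (hS : IsSegmentFamily T (fun _ => 2 ^ τ * n) (2 ^ τ * n) S) (hno : ¬ HasSegmentMinor T k S)
    (hM : ∀ i ∈ T, ∀ S', IsSegmentFamily (T.erase i) (fun _ => 2 ^ τ * n) (2 ^ τ * n) S' →
      ¬ HasSegmentMinor (T.erase i) k S' → S'.card ≤ M) :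
    ∃ S', IsSegmentFamily T (fun _ => n) n S' ∧ ¬ HasSegmentMinor T k S' ∧
      S.card ≤ (2 ^ (2 * k)) ^ (T.card + 1) * S'.card +
        (2 ^ (2 * k)) ^ (T.card + 1) * (T.card + 1) * ((2 ^ τ + 1) * (n * (M * (2 ^ τ * 2 ^ τ)))) := by
  classical
  have hnt : n ≤ 2 ^ τ * n := Nat.le_mul_of_pos_left _ (by positivity)
  set E := (2 ^ τ + 1) * (n * (M * (2 ^ τ * 2 ^ τ))) with hE
  set s := 2 ^ (2 * k) with hs
  have hs1 : 1 ≤ s := Nat.one_le_two_pow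
  have hs' : 2 ^ (2 * k - 1) + 1 ≤ s := by
    have h1 : 1 ≤ 2 ^ (2 * k - 1) := Nat.one_le_two_pow
    have h2 : s = 2 ^ (2 * k - 1) * 2 := by rw [hs, ← pow_succ]; congr 1; omega
    omega
  have key : ∀ T' ⊆ T, ∃ S', IsSegmentFamily T (fun i => if i ∈ T' then n else 2 ^ τ * n) n S' ∧
      ¬ HasSegmentMinor T k S' ∧
      S.card ≤ s ^ (T'.card + 1) * S'.card + s ^ (T'.card + 1) * (T'.card + 1) * E := by
    intro T'
    induction T' using Finset.induction_on with
    | empty =>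
      intro _
      obtain ⟨i, hi⟩ := hT
      obtain ⟨S', h1, h2, h3⟩ := exists_contract_longitudinal hS hi (l := 2 * k - 1) (by omega)
        le_rfl hno (hM i hi)
      refine ⟨S', by simpa using h1, h2, h3.trans ?_⟩
      simp only [Finset.card_empty, zero_add, pow_one, mul_one]
      exact Nat.add_le_add (Nat.mul_le_mul_right _ hs') (Nat.le_mul_of_pos_left _ hs1)
    | insert i T' hi ih =>
      intro hT'
      obtain ⟨S₁, h1, h2, h3⟩ := ih ((Finset.subset_insert i T').trans hT')
      have hiT := hT' (Finset.mem_insert_self i T')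
      obtain ⟨S₂, h4, h5, h6⟩ := exists_contract_transverse h1 hiT (k := k) (l := 2 * k - 1)
        (τ := τ) (n' := n) (M := M) (by omega) (by simp [hi]) h2 (fun S' hS' =>
          hM i hiT S' (hS'.mono (fun j _ => by split_ifs <;> omega) hnt))
      refine ⟨S₂, h4.mono (fun j _ => ?_) le_rfl, h5, ?_⟩
      · by_cases hji : j = i
        · subst hji; simp
        · simp [hji]
      · rw [Finset.card_insert_of_notMem hi]
        have h7 : S₁.card ≤ s * S₂.card + E := h6.trans (Nat.add_le_add
          (Nat.mul_le_mul_right _ (by omega)) (Nat.mul_le_mul_right _ (by omega)))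
        have hp : 1 ≤ s ^ (T'.card + 1) := Nat.one_le_pow _ _ hs1
        calc S.card ≤ s ^ (T'.card + 1) * S₁.card + s ^ (T'.card + 1) * (T'.card + 1) * E := h3
          _ ≤ s ^ (T'.card + 1) * (s * S₂.card + E) + s ^ (T'.card + 1) * (T'.card + 1) * E := by
            gcongr
          _ = s ^ (T'.card + 1 + 1) * S₂.card + s ^ (T'.card + 1) * (T'.card + 1 + 1) * E := by
            ring
          _ ≤ _ := by
            gcongr
            · exact Nat.le_succ _
  obtain ⟨S', h1, h2, h3⟩ := key T subset_rfl
  exact ⟨S', h1.mono (fun i hi => by simp [hi]) le_rfl, h2, h3⟩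

/-- A segment family without a minor of size `k` has at most `2 ^ O(k) * n ^ |T|` members. -/
theorem exists_card_le_of_not_hasSegmentMinor {ι : Type*} [DecidableEq ι] (D : ℕ) :
    ∃ C : ℕ, ∀ T : Finset ι, T.card = D → ∀ k n : ℕ, 1 ≤ k → 1 ≤ n →
      ∀ S, IsSegmentFamily T (fun _ => n) n S → ¬ HasSegmentMinor T k S →
        S.card ≤ 2 ^ (C * k) * n ^ D := by
  induction D with
  | zero =>
    refine ⟨1, fun T hT k n _ _ S hS hno => ?_⟩
    obtain rfl := Finset.card_eq_zero.mp hT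
    simpa using (card_le_of_not_hasSegmentMinor_empty hS hno).trans Nat.lt_two_pow_self.le
  | succ D ih =>
    obtain ⟨C, hC⟩ := ih
    -- `a k` is the coefficient of `n ^ (D + 1)` in the error term of `exists_contract` when `M` is
    -- the inductive bound `2 ^ (C * k) * (t * n) ^ D`.
    let a : ℕ → ℕ := fun k => 2 ^ (2 * k * (D + 2)) * (D + 2) *
      ((2 ^ (4 * k + 1) + 1) * (2 ^ (C * k) * (2 ^ (4 * k + 1)) ^ D *
        (2 ^ (4 * k + 1) * 2 ^ (4 * k + 1))))
    have hpow : ∀ T : Finset ι, T.card = D + 1 → ∀ k m : ℕ, 1 ≤ k →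
        ∀ S, IsSegmentFamily T (fun _ => 2 ^ ((4 * k + 1) * m)) (2 ^ ((4 * k + 1) * m)) S →
        ¬ HasSegmentMinor T k S → S.card ≤ a k * (2 ^ ((4 * k + 1) * m)) ^ (D + 1) := by
      intro T hT k m hk
      have hTn : T.Nonempty := Finset.card_pos.mp (by omega)
      have ha : 1 ≤ a k := Nat.pos_of_ne_zero (by positivity)
      induction m with
      | zero =>
        intro S hS _
        simp only [mul_zero, pow_zero] at hS
        simp only [mul_zero, pow_zero, one_pow, mul_one]
        refine le_trans (Finset.card_le_one.mpr fun u hu v hv => ?_) ha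
        have h1 : ∀ s ∈ S, s.1 = 0 := fun s hs => funext fun i => by
          by_cases hi : i ∈ T
          · exact Nat.lt_one_iff.mp (hS.lt s hs i hi)
          · exact hS.eq_zero s hs i hi
        have := hS.le u hu
        have := hS.le v hv
        have := hS.lt_bound u hu
        have := hS.lt_bound v hv
        exact Prod.ext ((h1 u hu).trans (h1 v hv).symm) (Prod.ext (by omega) (by omega))
      | succ m ihm =>
        intro S hS hno
        set t := 2 ^ (4 * k + 1) with ht
        set n := 2 ^ ((4 * k + 1) * m) with hn
        have e1 : 2 ^ ((4 * k + 1) * (m + 1)) = t * n := by rw [ht, hn, ← pow_add]; ring_nf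
        rw [e1] at hS ⊢
        have hn1 : 1 ≤ n := Nat.one_le_two_pow
        have ht1 : 1 ≤ t := Nat.one_le_two_pow
        obtain ⟨S', h1, h2, h3⟩ := exists_contract (τ := 4 * k + 1) (n := n) hk hTn hS hno
          (M := 2 ^ (C * k) * (t * n) ^ D) (fun i hi S' hS' hno' =>
            hC (T.erase i) (by rw [Finset.card_erase_of_mem hi]; omega) k _ hk
              (Nat.mul_pos ht1 hn1) S' hS' hno')
        have h4 := ihm S' h1 h2
        rw [hT, ← ht, ← pow_mul] at h3
        -- This is what fixes `t = 2 ^ (4 * k + 1)`: `D + 2` contraction losses and a factor `2` for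
        -- the error must fit into `D + 1` powers of `t`, already for `D = 0`.
        have h5 : 2 * 2 ^ (2 * k * (D + 2)) ≤ t ^ (D + 1) := by
          rw [ht, ← pow_succ', ← pow_mul]
          refine Nat.pow_le_pow_right (by norm_num) ?_
          nlinarith [Nat.zero_le (k * D)]
        calc S.card ≤ 2 ^ (2 * k * (D + 2)) * (a k * n ^ (D + 1)) + 2 ^ (2 * k * (D + 2)) * (D + 2) *
              ((t + 1) * (n * (2 ^ (C * k) * (t * n) ^ D * (t * t)))) := by
              refine h3.trans ?_
              gcongr
          _ = 2 ^ (2 * k * (D + 2)) * (a k * n ^ (D + 1)) + a k * n ^ (D + 1) := by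
              simp only [a, ← ht]
              ring
          _ ≤ (2 * 2 ^ (2 * k * (D + 2))) * (a k * n ^ (D + 1)) := by
              have : 1 ≤ 2 ^ (2 * k * (D + 2)) := Nat.one_le_two_pow
              nlinarith [Nat.zero_le (a k * n ^ (D + 1))]
          _ ≤ t ^ (D + 1) * (a k * n ^ (D + 1)) := Nat.mul_le_mul_right _ h5
          _ = _ := by rw [mul_pow]; ring
    refine ⟨13 * D + C + 27,
      fun T hT k n hk hn S hS hno => ?_⟩
    -- Rounding `n` up to a power of `t` costs at most a factor `t` per direction.
    obtain ⟨m, hm1, hm2⟩ : ∃ m, n ≤ 2 ^ ((4 * k + 1) * m) ∧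
        2 ^ ((4 * k + 1) * m) ≤ 2 ^ (4 * k + 1) * n := by
      have hex : ∃ m, n ≤ 2 ^ ((4 * k + 1) * m) := ⟨n, by
        calc n ≤ 2 ^ n := Nat.lt_two_pow_self.le
          _ ≤ _ := Nat.pow_le_pow_right (by norm_num) (Nat.le_mul_of_pos_left _ (by omega))⟩
      classical
      refine ⟨Nat.find hex, Nat.find_spec hex, ?_⟩
      rcases Nat.eq_zero_or_pos (Nat.find hex) with h0 | h0
      · rw [h0, mul_zero, pow_zero]
        exact Nat.mul_pos (by positivity) hn
      · have h1 := Nat.find_min hex (show Nat.find hex - 1 < Nat.find hex by omega)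
        have h2 : (4 * k + 1) * Nat.find hex = (4 * k + 1) + (4 * k + 1) * (Nat.find hex - 1) := by
          obtain ⟨q, hq⟩ := Nat.exists_eq_succ_of_ne_zero h0.ne'
          rw [hq]
          simp only [Nat.succ_eq_add_one, Nat.add_sub_cancel]
          ring
        rw [h2, pow_add]
        exact Nat.mul_le_mul_left _ (by omega)
    have h1 := hpow T hT k m hk S (hS.mono (fun _ _ => hm1) hm1) hno
    have hD : D + 2 ≤ 2 ^ ((D + 2) * k) := Nat.lt_two_pow_self.le.trans
      (Nat.pow_le_pow_right (by norm_num) (Nat.le_mul_of_pos_right _ hk))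
    have ht : 2 ^ (4 * k + 1) ≤ 2 ^ (5 * k) := Nat.pow_le_pow_right (by norm_num) (by omega)
    have ht' : 2 ^ (4 * k + 1) + 1 ≤ 2 ^ (6 * k) := by
      have h2 : 1 ≤ 2 ^ (4 * k + 1) := Nat.one_le_two_pow
      have h3 : 2 ^ (4 * k + 1 + 1) ≤ 2 ^ (6 * k) := Nat.pow_le_pow_right (by norm_num) (by omega)
      rw [pow_succ] at h3
      omega
    calc S.card ≤ a k * (2 ^ ((4 * k + 1) * m)) ^ (D + 1) := h1
      _ ≤ (2 ^ (2 * k * (D + 2)) * 2 ^ ((D + 2) * k) *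
          (2 ^ (6 * k) * (2 ^ (C * k) * (2 ^ (5 * k)) ^ D * (2 ^ (5 * k) * 2 ^ (5 * k))))) *
          (2 ^ (5 * k) * n) ^ (D + 1) := by
        have hm3 := hm2.trans (Nat.mul_le_mul_right n ht)
        dsimp only [a]
        gcongr
      _ = _ := by
        rw [mul_pow]
        simp only [← pow_mul, ← mul_assoc, ← pow_add]
        congr 2
        ring

/-! ### From ones in a matrix to segments -/

/-- A finite set of integers splits, up to fewer than `j` elements, into blocks of `j`. -/
theorem exists_blocks (j N : ℕ) (hj : 1 ≤ j) : ∀ (m lo : ℕ) (X : Finset ℕ), X.card = m →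
    (∀ x ∈ X, lo ≤ x ∧ x < N) →
    ∃ F : Finset (ℕ × ℕ), (∀ u ∈ F, lo ≤ u.1 ∧ u.1 ≤ u.2 ∧ u.2 < N ∧
        j ≤ (X.filter fun x => u.1 ≤ x ∧ x ≤ u.2).card) ∧
      (∀ u ∈ F, ∀ v ∈ F, u ≠ v → IntervalsDisjoint u v) ∧ X.card ≤ j * F.card + j := by
  intro m
  induction m using Nat.strong_induction_on with
  | _ m ih =>
  intro lo X hm hX
  rcases Nat.lt_or_ge X.card j with hlt | hge
  · exact ⟨∅, by simp, by simp, by simpa using hlt.le⟩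
  have hex : ∃ b, j ≤ (X.filter (· ≤ b)).card :=
    ⟨N, by rwa [Finset.filter_true_of_mem fun x hx => (hX x hx).2.le]⟩
  classical
  -- `b` is the `j`-th smallest element of `X`, so the first block is `[lo, b]`.
  set b := Nat.find hex with hb
  have hbj := Nat.find_spec hex
  rw [← hb] at hbj
  have hlt' : (X.filter (· < b)).card < j := by
    rcases Nat.eq_zero_or_pos b with h0 | h0
    · simpa [h0] using Nat.lt_of_succ_le hj
    · have := Nat.find_min hex (show b - 1 < b by omega)
      rw [show X.filter (· < b) = X.filter (· ≤ b - 1) from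
        Finset.filter_congr fun x _ => by omega]
      omega
  have hbX : b ∈ X := by
    by_contra hbX
    rw [Finset.filter_congr (q := (· < b)) fun x hx => by
      have : x ≠ b := by rintro rfl; exact hbX hx
      omega] at hbj
    omega
  have hcard : X.card ≤ (X.filter (· < b)).card + 1 + (X.filter (b < ·)).card := by
    have hcov : X ⊆ (X.filter (· < b) ∪ {b}) ∪ X.filter (b < ·) := by
      intro x hx
      simp only [Finset.mem_union, Finset.mem_filter, Finset.mem_singleton, hx, true_and]
      omega
    have h1 := Finset.card_le_card hcov
    have h2 := Finset.card_union_le (X.filter (· < b) ∪ {b}) (X.filter (b < ·))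
    have h3 := Finset.card_union_le (X.filter (· < b)) {b}
    rw [Finset.card_singleton] at h3
    omega
  have hsub : X.filter (b < ·) ⊆ X := Finset.filter_subset _ _
  have hlt : (X.filter (b < ·)).card < m := by
    rw [← hm]
    refine Finset.card_lt_card (Finset.ssubset_iff_subset_ne.mpr ⟨hsub, fun h => ?_⟩)
    rw [← h] at hbX
    exact lt_irrefl _ (Finset.mem_filter.mp hbX).2
  obtain ⟨F, hF, hF', hFc⟩ := ih _ hlt (b + 1) _ rfl fun x hx =>
    ⟨(Finset.mem_filter.mp hx).2, (hX x (hsub hx)).2⟩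
  have hlob := (hX b hbX).1
  have hnot : (lo, b) ∉ F := fun h => by
    have := (hF _ h).1
    dsimp only at this
    omega
  refine ⟨insert (lo, b) F, fun u hu => ?_, fun u hu v hv huv => ?_, ?_⟩
  · rcases Finset.mem_insert.mp hu with rfl | hu
    · refine ⟨le_rfl, hlob, (hX b hbX).2, hbj.trans (Finset.card_le_card fun x hx => ?_)⟩
      obtain ⟨hx, hxb⟩ := Finset.mem_filter.mp hx
      exact Finset.mem_filter.mpr ⟨hx, (hX x hx).1, hxb⟩
    · obtain ⟨h1, h2, h3, h4⟩ := hF u hu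
      exact ⟨by omega, h2, h3, h4.trans (Finset.card_le_card
        (Finset.filter_subset_filter _ hsub))⟩
  · rcases Finset.mem_insert.mp hu with rfl | hu <;> rcases Finset.mem_insert.mp hv with rfl | hv
    · exact absurd rfl huv
    · exact Or.inl (hF v hv).1
    · exact Or.inr (hF u hu).1
    · exact hF' u hu v hv huv
  · rw [Finset.card_insert_of_notMem hnot, mul_add, mul_one]
    omega

namespace ZeroOneMatrix

/-- A matrix with more than `j * 2 ^ O(k) * n ^ (d - 1)` ones has a `k × ⋯ × k` grid of boxes each
of which contains `j` ones on a common line in direction `l`. -/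
theorem exists_cuts_of_lt_weight (d : ℕ) : ∃ C : ℕ, ∀ (l : Fin d) (k n j : ℕ), 1 ≤ k →
    1 ≤ n → 1 ≤ j → ∀ A : ZeroOneMatrix (fun _ : Fin d => n),
      j * 2 ^ (C * k) * n ^ (d - 1) < A.weight →
      ∃ c : Fin d → ℕ → ℕ, (∀ i, Monotone (c i)) ∧ ∀ z : Fin d → ℕ, (∀ i, z i < k) →
        ∃ y : Fin d → Fin n, (∀ i ≠ l, c i (z i) ≤ y i ∧ y i < c i (z i + 1)) ∧
          j ≤ (Finset.univ.filter fun v : Fin n => (c l (z l) ≤ v ∧ v < c l (z l + 1)) ∧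
            A (Function.update y l v) = true).card := by
  obtain ⟨C, hC⟩ := exists_card_le_of_not_hasSegmentMinor (ι := Fin d) (d - 1)
  refine ⟨C + 1, fun l k n j hk hn hj A hA => ?_⟩
  -- `ρ` names the line through `x` in direction `l`; the value `0` at `l` is the normalization that
  -- `IsSegmentFamily` requires outside `T`.
  let ρ : (Fin d → Fin n) → Fin d → ℕ := fun x => Function.update (fun i => (x i : ℕ)) l 0
  have hρ : ∀ x, ∀ i ≠ l, ρ x i = x i := fun x i hi => by simp [ρ, hi]
  have hρeq : ∀ x y, ρ x = ρ y → x = Function.update y l (x l) := fun x y h => funext fun i => by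
    by_cases hi : i = l
    · subst hi; simp
    · rw [Function.update_of_ne hi]
      exact Fin.ext (by rw [← hρ x i hi, h, hρ y i hi])
  let Z := Finset.univ.filter fun x => A x = true
  let B := Z.image ρ
  let fib : (Fin d → ℕ) → Finset (Fin d → Fin n) := fun Y => Z.filter fun x => ρ x = Y
  let X : (Fin d → ℕ) → Finset ℕ := fun Y => (fib Y).image fun x => (x l : ℕ)
  have hXcard : ∀ Y, (X Y).card = (fib Y).card := fun Y =>
    Finset.card_image_of_injOn fun x hx x' hx' h => by
      rw [hρeq x x' ((Finset.mem_filter.mp hx).2.trans (Finset.mem_filter.mp hx').2.symm),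
        Fin.ext h, Function.update_eq_self]
  choose F hF hF' hFc using fun Y => exists_blocks j n hj _ 0 (X Y) rfl fun x hx => by
    obtain ⟨x, -, rfl⟩ := Finset.mem_image.mp hx
    exact ⟨Nat.zero_le _, (x l).2⟩
  obtain ⟨S, hS, hScard⟩ := exists_finset_sigma B F
  have hBcard : B.card ≤ n ^ (d - 1) := by
    have hsub : B ⊆ Fintype.piFinset fun i => if i = l then {0} else Finset.range n := by
      intro Y hY
      obtain ⟨x, -, rfl⟩ := Finset.mem_image.mp hY
      refine Fintype.mem_piFinset.mpr fun i => ?_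
      by_cases hi : i = l
      · simp [ρ, hi]
      · simp [hρ x i hi, hi]
    refine (Finset.card_le_card hsub).trans (le_of_eq ?_)
    rw [Fintype.card_piFinset, ← Finset.mul_prod_erase _ _ (Finset.mem_univ l)]
    rw [Finset.prod_congr rfl fun i hi => by rw [if_neg (Finset.ne_of_mem_erase hi)]]
    simp
  have hweight : A.weight ≤ j * S.card + j * n ^ (d - 1) := by
    have h1 : A.weight = ∑ Y ∈ B, (fib Y).card :=
      Finset.card_eq_sum_card_fiberwise fun x hx => Finset.mem_image_of_mem _ hx
    calc A.weight = ∑ Y ∈ B, (X Y).card := by rw [h1]; simp only [hXcard]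
      _ ≤ ∑ Y ∈ B, (j * (F Y).card + j) := Finset.sum_le_sum fun Y _ => hFc Y
      _ = j * S.card + j * B.card := by
        rw [Finset.sum_add_distrib, hScard, Finset.mul_sum, Finset.sum_const, smul_eq_mul,
          mul_comm B.card]
      _ ≤ _ := by gcongr
  have hfam : IsSegmentFamily (Finset.univ.erase l) (fun _ => n) n S := by
    refine ⟨fun s hs i hi => ?_, fun s hs i hi => ?_, fun s hs => ?_, fun s hs => ?_,
      fun s hs s' hs' h hne => ?_⟩
    · obtain ⟨x, -, hx⟩ := Finset.mem_image.mp ((hS s.1 s.2).mp hs).1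
      obtain rfl : i = l := by simpa using hi
      simp [← hx, ρ]
    · obtain ⟨x, -, hx⟩ := Finset.mem_image.mp ((hS s.1 s.2).mp hs).1
      rw [← hx, hρ x i (Finset.ne_of_mem_erase hi)]
      exact (x i).2
    · exact (hF _ _ ((hS s.1 s.2).mp hs).2).2.1
    · exact (hF _ _ ((hS s.1 s.2).mp hs).2).2.2.1
    · have h1 := ((hS s.1 s.2).mp hs).2
      have h2 := ((hS s'.1 s'.2).mp hs').2
      rw [← h] at h2
      exact hF' _ _ h1 _ h2 fun h' => hne (Prod.ext h h')
  obtain ⟨c, e, hc, he, hce⟩ : HasSegmentMinor (Finset.univ.erase l) k S := by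
    by_contra hno
    have h1 := hC _ (by simp) k n hk hn S hfam hno
    refine absurd hA (not_lt.mpr (hweight.trans ?_))
    -- The `+ 1` pays for the incomplete block left over on each of at most `n ^ (d - 1)` lines.
    have h2 : 2 ^ (C * k) + 1 ≤ 2 ^ ((C + 1) * k) := by
      have h3 : 1 ≤ 2 ^ (C * k) := Nat.one_le_two_pow
      have h4 : 2 ^ (C * k + 1) ≤ 2 ^ ((C + 1) * k) :=
        Nat.pow_le_pow_right (by norm_num) (by rw [add_mul]; omega)
      rw [pow_succ] at h4
      omega
    calc j * S.card + j * n ^ (d - 1)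
        ≤ j * (2 ^ (C * k) * n ^ (d - 1)) + j * n ^ (d - 1) := by gcongr
      _ = j * (2 ^ (C * k) + 1) * n ^ (d - 1) := by ring
      _ ≤ _ := by gcongr
  refine ⟨Function.update c l e, fun i => ?_, fun z hz => ?_⟩
  · by_cases hi : i = l
    · subst hi
      rwa [Function.update_self]
    · rw [Function.update_of_ne hi]
      exact hc i
  · obtain ⟨s, hs, h1, h2, h3⟩ := hce z (fun i _ => hz i) (z l) (hz l)
    obtain ⟨hsB, hsF⟩ := (hS s.1 s.2).mp hs
    obtain ⟨y, -, hy⟩ := Finset.mem_image.mp hsB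
    refine ⟨y, fun i hi => ?_, ?_⟩
    · rw [Function.update_of_ne hi, ← hρ y i hi, hy]
      exact h1 i (by simp [hi])
    · refine ((hF _ _ hsF).2.2.2).trans ?_
      rw [← Finset.card_image_of_injective _ (Fin.val_injective (n := n))]
      refine Finset.card_le_card fun v hv => ?_
      obtain ⟨hv, hv1, hv2⟩ := Finset.mem_filter.mp hv
      obtain ⟨x, hx, rfl⟩ := Finset.mem_image.mp hv
      obtain ⟨hxZ, hxs⟩ := Finset.mem_filter.mp hx
      refine Finset.mem_image.mpr ⟨x l, Finset.mem_filter.mpr ⟨Finset.mem_univ _, ?_, ?_⟩, rfl⟩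
      · rw [Function.update_self]
        omega
      · rw [← hρeq x y (hxs.trans hy.symm)]
        exact (Finset.mem_filter.mp hxZ).2

/-! ### Interval minors, permutation matrices and tuples -/

theorem exists_minorExtremal_allOnes_le (d : ℕ) (hd : 1 ≤ d) : ∃ C : ℕ, ∀ k n : ℕ, 1 ≤ k → 1 ≤ n →
    minorExtremal n (allOnes fun _ : Fin d => k) ≤ 2 ^ (C * k) * n ^ (d - 1) := by
  obtain ⟨C, hC⟩ := exists_cuts_of_lt_weight d
  classical
  refine ⟨C, fun k n hk hn => Finset.sup_le fun A hA => ?_⟩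
  by_contra! hlt
  refine (Finset.mem_filter.mp hA).2 ?_
  let l : Fin d := ⟨0, hd⟩
  obtain ⟨c, hc, hcz⟩ := hC l k n 1 hk hn le_rfl A (by simpa using hlt)
  have hpt : ∀ z : Fin d → ℕ, (∀ i, z i < k) → ∃ x : Fin d → Fin n,
      (∀ i, c i (z i) ≤ x i ∧ x i < c i (z i + 1)) ∧ A x = true := fun z hz => by
    obtain ⟨y, hy, h⟩ := hcz z hz
    obtain ⟨v, hv⟩ := Finset.card_pos.mp h
    obtain ⟨-, hv, hAv⟩ := Finset.mem_filter.mp hv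
    refine ⟨_, fun i => ?_, hAv⟩
    by_cases hi : i = l
    · subst hi
      rwa [Function.update_self]
    · rw [Function.update_of_ne hi]
      exact hy i hi
  have hlt' : ∀ (i : Fin d) (r : Fin k), c i r < n ∧ c i r < c i (r + 1) := fun i r => by
    obtain ⟨x, hx, -⟩ := hpt (fun _ => r) fun _ => r.2
    have h1 := hx i
    have h2 := (x i).2
    omega
  -- The cuts are not known to be bounded by `n`, so right ends are truncated to `n - 1`.
  refine ⟨fun i r => ⟨c i r, (hlt' i r).1⟩, fun i r => ⟨min (c i (r + 1) - 1) (n - 1),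
      (min_le_right _ _).trans_lt (Nat.sub_lt hn one_pos)⟩,
    fun i r => ?_, fun i r r' hr => ?_, fun y _ => ?_⟩
  · have := hlt' i r
    simp only [Fin.mk_le_mk]
    omega
  · have h1 := hlt' i r
    have h2 := hc i (show (r : ℕ) + 1 ≤ r' from hr)
    simp only [Fin.mk_lt_mk]
    omega
  · obtain ⟨x, hx, hAx⟩ := hpt (fun i => y i) fun i => (y i).2
    refine ⟨x, fun i => ?_, hAx⟩
    have h1 := hx i
    have h2 := (x i).2
    simp only [Fin.le_def]
    omega

/-- Pick a one in every block. The cross section of `A` for index `c` in direction `i` is taken from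
the block at the unique 1-entry `y i c` of `P`. A 1-entry `z` is `y i (z i)` for every `i`, so all
its coordinates come from the same one of `A`. -/
theorem Contains.of_allOnes_minor {d k n : ℕ} {A : ZeroOneMatrix (fun _ : Fin d => n)}
    (h : A.ContainsIntervalMinor (allOnes fun _ : Fin d => k))
    {P : ZeroOneMatrix (fun _ : Fin d => k)} (hP : P.IsPermutation) : A.Contains P := by
  obtain ⟨a, b, hab, hba, h⟩ := h
  choose x hx hAx using fun y => h y rfl
  choose y hy hyu using fun i c => hP i c
  refine ⟨fun i => OrderEmbedding.ofStrictMono (fun c => x (y i c) i) fun c c' hc => ?_,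
    fun z hz => ?_⟩
  · have h1 := (hx (y i c) i).2
    have h2 := (hx (y i c') i).1
    rw [(hy i c).1] at h1
    rw [(hy i c').1] at h2
    exact (h1.trans_lt (hba i c c' hc)).trans_le h2
  · have h1 : ∀ i, y i (z i) = z := fun i => (hyu i (z i) z ⟨rfl, hz⟩).symm
    change A (fun i => x (y i (z i)) i) = true
    simp only [h1]
    exact hAx z

theorem extremal_le_minorExtremal_allOnes {d k : ℕ} (n : ℕ)
    {P : ZeroOneMatrix (fun _ : Fin d => k)} (hP : P.IsPermutation) :
    extremal n P ≤ minorExtremal n (allOnes fun _ : Fin d => k) := by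
  classical
  refine Finset.sup_mono fun A hA => ?_
  obtain ⟨-, hA⟩ := Finset.mem_filter.mp hA
  exact Finset.mem_filter.mpr ⟨Finset.mem_univ _, fun h => hA (Contains.of_allOnes_minor h hP)⟩

/-- The same embedding, except that each box now offers `j` ones on a line in direction `l`, which
receive the `j` copies of the corresponding 1-entry. -/
theorem exists_extremal_tuple_le (d : ℕ) : ∃ C : ℕ, ∀ k : ℕ, 1 ≤ k →
    ∀ P : ZeroOneMatrix (fun _ : Fin d => k), P.IsPermutation → ∀ (l : Fin d) (j n : ℕ), 1 ≤ j →
      1 ≤ n → extremal n (P.tuple l j) ≤ j * 2 ^ (C * k) * n ^ (d - 1) := by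
  obtain ⟨C, hC⟩ := exists_cuts_of_lt_weight d
  classical
  refine ⟨C, fun k hk P hP l j n hj hn => Finset.sup_le fun A hA => ?_⟩
  by_contra! hlt
  refine (Finset.mem_filter.mp hA).2 ?_
  obtain ⟨c, hc, hcz⟩ := hC l k n j hk hn hj A hlt
  choose w hw hwj using fun y : Fin d → Fin k => hcz (fun i => y i) fun i => (y i).2
  let V : (Fin d → Fin k) → Finset (Fin n) := fun y => Finset.univ.filter fun v : Fin n =>
    (c l (y l) ≤ v ∧ v < c l (y l + 1)) ∧ A (Function.update (w y) l v) = true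
  let pos : (Fin d → Fin k) → Fin j ↪o Fin n := fun y => (V y).orderEmbOfCardLe (hwj y)
  have hpos : ∀ y r, (c l (y l) ≤ pos y r ∧ pos y r < c l (y l + 1)) ∧
      A (Function.update (w y) l (pos y r)) = true := fun y r =>
    (Finset.mem_filter.mp (Finset.orderEmbOfCardLe_mem (V y) (hwj y) r)).2
  choose y hy hyu using fun i c => hP i c
  let r : ∀ i, Fin (Function.update (fun _ : Fin d => 1) l j i) → Fin j := fun i q =>
    if h : i = l then ⟨q, by have := q.2; subst h; simpa using this⟩ else ⟨0, hj⟩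
  let g : ∀ i, Fin (k * Function.update (fun _ : Fin d => 1) l j i) → Fin n := fun i x =>
    Function.update (w (y i x.divNat)) l (pos (y i x.divNat) (r i x.modNat)) i
  have hg : ∀ i x, c i x.divNat ≤ g i x ∧ g i x < c i (x.divNat + 1) := by
    intro i x
    by_cases hi : i = l
    · subst hi
      have := (hpos (y i x.divNat) (r i x.modNat)).1
      rw [(hy i _).1] at this
      simpa [g] using this
    · have := hw (y i x.divNat) i hi
      rw [(hy i _).1] at this
      simpa [g, hi] using this
  have hmono : ∀ i, StrictMono (g i) := by
    intro i x x' hx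
    -- Indices in different blocks are separated by the cuts. Within a block the order is that of
    -- `pos`, and in directions other than `l` a block has a single index.
    have hle : x.divNat ≤ x'.divNat := Nat.div_le_div_right (show (x : ℕ) ≤ x' from hx.le)
    rcases hle.lt_or_eq with h | h
    · have h1 := hg i x
      have h2 := hg i x'
      have h3 := hc i (show (x.divNat : ℕ) + 1 ≤ x'.divNat from h)
      exact Fin.lt_def.mpr (by omega)
    · have hmod : (x.modNat : ℕ) < x'.modNat := by
        have h1 := congrArg Fin.val h
        have h2 : (x : ℕ) < x' := hx
        rw [Fin.coe_divNat, Fin.coe_divNat] at h1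
        rw [Fin.coe_modNat, Fin.coe_modNat]
        have h3 := Nat.div_add_mod (x : ℕ) (Function.update (fun _ : Fin d => 1) l j i)
        have h4 := Nat.div_add_mod (x' : ℕ) (Function.update (fun _ : Fin d => 1) l j i)
        rw [h1] at h3
        omega
      by_cases hi : i = l
      · subst hi
        simp only [g, h, Function.update_self]
        refine (pos _).strictMono ?_
        simpa [r] using hmod
      · have h1 := x'.modNat.2
        have h2 : Function.update (fun _ : Fin d => 1) l j i = 1 := Function.update_of_ne hi _ _
        omega
  refine ⟨fun i => OrderEmbedding.ofStrictMono (g i) (hmono i), fun x hx => ?_⟩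
  have hPx : P (fun i => (x i).divNat) = true := by
    simp only [tuple, kronecker, Bool.and_eq_true] at hx
    exact hx.1
  have h1 : ∀ i, y i (x i).divNat = fun i => (x i).divNat :=
    fun i => (hyu i _ _ ⟨rfl, hPx⟩).symm
  have h2 := (hpos (fun i => (x i).divNat) (r l (x l).modNat)).2
  convert h2 using 2
  funext i
  by_cases hi : i = l
  · subst hi
    simp [g, h1]
  · simp [g, h1, hi]

theorem limsupExtremal_le {d : ℕ} {p : Fin d → ℕ} {P : ZeroOneMatrix p} {K : ℕ}
    (h : ∀ n, 1 ≤ n → extremal n P ≤ K * n ^ (d - 1)) :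
    limsupExtremal P ≤ (((K : ℕ) : ℝ) : EReal) := by
  refine Filter.limsup_le_of_le (by isBoundedDefault) ?_
  filter_upwards [Filter.eventually_ge_atTop 1] with n hn
  refine EReal.coe_le_coe_iff.mpr ?_
  rw [div_le_iff₀ (by positivity)]
  exact_mod_cast h n hn

end ZeroOneMatrix

theorem theorem4p1 (d : ℕ) (hd : 1 ≤ d) :
    ∃ C : ℕ, ∀ k : ℕ, 1 ≤ k →
      (∀ P : ZeroOneMatrix (fun _ : Fin d => k), P.IsPermutation →
        ZeroOneMatrix.limsupExtremal P ≤ (((2 : ℝ) ^ (C * k) : ℝ) : EReal) ∧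
        ∀ (l : Fin d) (j : ℕ), 1 ≤ j →
          ZeroOneMatrix.limsupExtremal (P.tuple l j) ≤
            (((j : ℝ) * (2 : ℝ) ^ (C * k) : ℝ) : EReal)) ∧
      ∀ n : ℕ, 1 ≤ n →
        ZeroOneMatrix.minorExtremal n (ZeroOneMatrix.allOnes (fun _ : Fin d => k)) ≤
          2 ^ (C * k) * n ^ (d - 1) := by
  obtain ⟨C₁, h₁⟩ := ZeroOneMatrix.exists_minorExtremal_allOnes_le d hd
  obtain ⟨C₂, h₂⟩ := ZeroOneMatrix.exists_extremal_tuple_le d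
  have e₁ : ∀ k, 2 ^ (C₁ * k) ≤ 2 ^ ((C₁ + C₂) * k) := fun k =>
    Nat.pow_le_pow_right (by norm_num) (Nat.mul_le_mul_right _ (by omega))
  have e₂ : ∀ k, 2 ^ (C₂ * k) ≤ 2 ^ ((C₁ + C₂) * k) := fun k =>
    Nat.pow_le_pow_right (by norm_num) (Nat.mul_le_mul_right _ (by omega))
  have hminor : ∀ k n, 1 ≤ k → 1 ≤ n →
      ZeroOneMatrix.minorExtremal n (ZeroOneMatrix.allOnes (fun _ : Fin d => k)) ≤
        2 ^ ((C₁ + C₂) * k) * n ^ (d - 1) := fun k n hk hn =>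
    (h₁ k n hk hn).trans (Nat.mul_le_mul_right _ (e₁ k))
  refine ⟨C₁ + C₂, fun k hk => ⟨fun P hP => ⟨?_, fun l j hj => ?_⟩, fun n hn => hminor k n hk hn⟩⟩
  · have h := ZeroOneMatrix.limsupExtremal_le (P := P) (K := 2 ^ ((C₁ + C₂) * k)) fun n hn =>
      (ZeroOneMatrix.extremal_le_minorExtremal_allOnes n hP).trans (hminor k n hk hn)
    exact_mod_cast h
  · have h := ZeroOneMatrix.limsupExtremal_le (P := P.tuple l j)
      (K := j * 2 ^ ((C₁ + C₂) * k)) fun n hn => (h₂ k hk P hP l j n hj hn).trans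
        (Nat.mul_le_mul_right _ (Nat.mul_le_mul_left _ (e₂ k)))
    exact_mod_cast h
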